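/- All Hilbert spaces are finite-dimensional and $\log$ denotes the logarithm to base $2$. Write $\mathcal S(\mathscr H)$ for the positive semi-definite operators of trace $1$ and $\mathcal S_{\le}(\mathscr H)$ for those with trace in $(0,1]$. For $\rho,\sigma\in\mathcal S_{\le}(\mathscr H)$ let $$F(\rho,\sigma)=\operatorname{tr}|\sqrt\rho\sqrt\sigma|+\sqrt{(1-\operatorname{tr}\rho)(1-\operatorname{tr}\sigma)},\qquad P(\rho,\sigma)=\sqrt{1-F(\rho,\sigma)^2}$$ be the generalized fidelity and the purified distance. For $0\le\varepsilon<1$ and $\rho_{AB}\in\mathcal S(\mathscr H_A\otimes\mathscr H_B)$ the smooth min-entropy is $$H_{\min}^{\varepsilon}(A|B)_\rho=\sup_{\sigma_B\in\mathcal S(\mathscr H_B)}\ -\inf_{\tilde\rho_{AB}\in\mathcal S_{\le}(\mathscr H_A\otimes\mathscr H_B),\ P(\tilde\rho,\rho)\le\varepsilon}\ \inf\{\lambda\in\mathbb R:\tilde\rho_{AB}\le 2^{\lambda}\,1_A\otimes\sigma_B\}$$ (with $\inf\emptyset=+\infty$). Let $\rho_{XB}=\sum_x p_x|x\rangle\langle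 x|\otimes\phi_B^x$ be a classical-quantum state, where $p$ is a probability distribution on a finite set $X$, $\{|x\rangle\}$ is an orthonormal basis of $\mathscr H_X$ and $\phi_B^x\in\mathcal S(\mathscr H_B)$. A protocol $\mathcal P$ consists of a finite seed set $\mathcal S$, a finite output set $\mathcal Z$, a probability distribution $(p_s)_{s\in\mathcal S}$ and a function $h_s:X\to\mathcal Z$ for every $s\in\mathcal S$. Its final state is $$\tau_{ZBS}=\sum_{s}p_s\,\Big(\sum_{z}|z\rangle\langle z|\otimes\sum_{x\in h_s^{-1}(z)}p_x\phi_B^x\Big)\otimes|s\rangle\langle s| ,$$ and, with $\pi_Z=1_Z/|\mathcal Z|$ and $\tau_S=\sum_s p_s|s\rangle\langle s|$, $$d_{\rm sec}(\mathcal P,\rho_{XB})=\inf_{\sigma_B\in\mathcal S(\mathscr H_B)}P(\tau_{ZBS},\ \pi_Z\otimes\sigma_B\otimes\tau_S).$$ The maximal extractable randomness is $$\ell^{\varepsilon}(X|B)_\rho=\max\{\ell\in\mathbb N_0:\ \exists\,\mathcal P\text{ with }\log|\mathcal Z|\ge\ell\text{ and }d_{\rm sec}(\mathcal P,\rho_{XB})\le\varepsilon\}.$$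 **Theorem.** For every classical-quantum state $\rho_{XB}$ and all $0<\eta\le\varepsilon<1$, the maximum defining $\ell^{\varepsilon}(X|B)_\rho$ exists, and $$H_{\min}^{\varepsilon-\eta}(X|B)_\rho-\log\frac1{\eta^4}-3\ \le\ \ell^{\varepsilon}(X|B)_\rho\ \le\ H_{\min}^{\varepsilon}(X|B)_\rho .$$ -/

import Mathlib

open scoped MatrixOrder ComplexOrder Kronecker

noncomputable section

namespace OneShot

/-! Operators on the finite-dimensional Hilbert space `ℂ^n` are complex matrices indexed by the
finite type `n`; the tensor product of `ℂ^m` and `ℂ^n` is `ℂ^(m × n)`; `≤` is the Loewner order;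
logarithms have base two. -/

section Operators

variable {n : Type*} [Fintype n] [DecidableEq n]

/-- Quantum states: positive semi-definite operators of unit trace. -/
def IsState (ρ : Matrix n n ℂ) : Prop :=
  ρ.PosSemidef ∧ ρ.trace = 1

/-- Sub-normalized quantum states: positive semi-definite operators with trace in `(0, 1]`. -/
def IsSubState (ρ : Matrix n n ℂ) : Prop :=
  ρ.PosSemidef ∧ 0 < ρ.trace.re ∧ ρ.trace.re ≤ 1

/-- Generalized fidelity `tr |√ρ √σ| + √((1 - tr ρ) (1 - tr σ))`. -/
def fidelity (ρ σ : Matrix n n ℂ) : ℝ :=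
  (CFC.abs (CFC.sqrt ρ * CFC.sqrt σ)).trace.re
    + Real.sqrt ((1 - ρ.trace.re) * (1 - σ.trace.re))

/-- Purified distance `√(1 - F(ρ, σ)²)`. -/
def purifiedDistance (ρ σ : Matrix n n ℂ) : ℝ :=
  Real.sqrt (1 - fidelity ρ σ ^ 2)

/-- Relative max-entropy `inf {t ∈ ℝ | ρ ≤ 2^t σ}`, which is `⊤` if there is no such `t`. -/
def dMax (ρ σ : Matrix n n ℂ) : EReal :=
  ⨅ (t : ℝ) (_ : ρ ≤ (2 : ℝ) ^ t • σ), (t : EReal)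

/-- Smooth relative max-entropy: the least relative max-entropy over all sub-normalized states
within purified distance `ε` of `ρ`. -/
def smoothDMax (ε : ℝ) (ρ σ : Matrix n n ℂ) : EReal :=
  ⨅ (ρ' : Matrix n n ℂ) (_ : IsSubState ρ' ∧ purifiedDistance ρ' ρ ≤ ε), dMax ρ' σ

end Operators

section Bipartite

variable {A B : Type*} [Fintype A] [DecidableEq A] [Fintype B] [DecidableEq B]

/-- Smooth min-entropy of `A` given `B`: the supremum over states `σ` on `B` of the negative smooth
relative max-entropy of `ρ` with respect to `1 ⊗ σ`. -/
def smoothHMin (ε : ℝ) (ρ : Matrix (A × B) (A × B) ℂ) : EReal :=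
  ⨆ (σ : Matrix B B ℂ) (_ : IsState σ), -smoothDMax ε ρ ((1 : Matrix A A ℂ) ⊗ₖ σ)

end Bipartite

/-- A classical-quantum state, given by a probability distribution `prob` on `X` and a family of
states `cond x` on `B`. -/
structure CQState (X B : Type*) [Fintype X] [Fintype B] where
  prob : X → ℝ
  prob_nonneg : ∀ x, 0 ≤ prob x
  prob_sum : ∑ x, prob x = 1
  cond : X → Matrix B B ℂ
  cond_isState : ∀ x, IsState (cond x)

/-- The density operator `∑ x, p_x |x⟩⟨x| ⊗ φ^x`. -/
def CQState.op {X B : Type*} [Fintype X] [DecidableEq X] [Fintype B] (ρ : CQState X B) :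
    Matrix (X × B) (X × B) ℂ :=
  ∑ x, ρ.prob x • (Matrix.single x x (1 : ℂ) ⊗ₖ ρ.cond x)

/-- A randomized extraction protocol: a finite seed set, a finite output set, a probability
distribution on the seeds and a hash function for every seed. -/
structure Protocol (X : Type*) where
  Seed : Type
  Out : Type
  [fintypeSeed : Fintype Seed]
  [decEqSeed : DecidableEq Seed]
  [fintypeOut : Fintype Out]
  [decEqOut : DecidableEq Out]
  prob : Seed → ℝ
  prob_nonneg : ∀ s, 0 ≤ prob s
  prob_sum : ∑ s, prob s = 1
  hash : Seed → X → Out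

attribute [instance] Protocol.fintypeSeed Protocol.decEqSeed Protocol.fintypeOut
  Protocol.decEqOut

section Extraction

variable {X B : Type*} [Fintype X] [DecidableEq X] [Fintype B] [DecidableEq B]

/-- `∑ z, |z⟩⟨z| ⊗ ∑ x ∈ h_s⁻¹(z), p_x φ^x`, the output for the seed `s`. -/
def Protocol.outputGiven (P : Protocol X) (ρ : CQState X B) (s : P.Seed) :
    Matrix (P.Out × B) (P.Out × B) ℂ :=
  ∑ z, Matrix.single z z (1 : ℂ) ⊗ₖ ∑ x with P.hash s x = z, ρ.prob x • ρ.cond x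

/-- The final state on output, side information and seed. -/
def Protocol.final (P : Protocol X) (ρ : CQState X B) :
    Matrix ((P.Out × B) × P.Seed) ((P.Out × B) × P.Seed) ℂ :=
  ∑ s, P.prob s • (P.outputGiven ρ s ⊗ₖ Matrix.single s s (1 : ℂ))

/-- The state `∑ s, p_s |s⟩⟨s|` of the seed. -/
def Protocol.seedState (P : Protocol X) : Matrix P.Seed P.Seed ℂ :=
  ∑ s, P.prob s • Matrix.single s s (1 : ℂ)

/-- The fully mixed state on the output. -/
def Protocol.uniform (P : Protocol X) : Matrix P.Out P.Out ℂ :=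
  (Fintype.card P.Out : ℝ)⁻¹ • (1 : Matrix P.Out P.Out ℂ)

/-- Distance of the final state from an ideal one, in which the output is uniform and independent
of the side information and the seed. -/
def Protocol.secrecyDistance (P : Protocol X) (ρ : CQState X B) : ℝ :=
  ⨅ σ : {σ : Matrix B B ℂ // IsState σ},
    purifiedDistance (P.final ρ) ((P.uniform ⊗ₖ σ.1) ⊗ₖ P.seedState)

/-- The numbers of bits that can be extracted with secrecy distance at most `ε`. -/
def extractableLengths (ε : ℝ) (ρ : CQState X B) : Set ℕ :=
  {l | ∃ P : Protocol X,
    (l : ℝ) ≤ Real.logb 2 (Fintype.card P.Out) ∧ P.secrecyDistance ρ ≤ ε}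

/-- The maximal extractable randomness. -/
def extractableRandomness (ε : ℝ) (ρ : CQState X B) : ℕ :=
  sSup (extractableLengths ε ρ)

end Extraction

end OneShot

end

set_option linter.unusedSectionVars false

noncomputable section

namespace OneShot

open Matrix

/-! ### Loewner order, trace inner product and factorization through a square root -/

section MatrixFacts

variable {m n : Type*} [Fintype m] [Fintype n]

/-! Everything about fidelity rests on one variational formula: tr |√A √B| is the largest value of
Re tr(a bᴴ) over a, b with aᴴa ≤ A and bᴴb ≤ B (`reInner_le_rootFid`, `exists_rootFid_eq_reInner`).
Such a and b play the role of purifications, so this is Uhlmann's theorem without an ancilla.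
Symmetry, monotonicity, superadditivity, additivity over blocks and the triangle inequality all
follow by exhibiting suitable a and b.

Upper bound. Let a protocol reach distance ε. By compactness some σ attains the infimum, and some
seed s has at least the average fidelity. For each output z, the operator ω = σ/|Z| is compared with
∑ p_x φ^x over the fibre of z. By `exists_extension`, ω dominates a sum of operators indexed by that
fibre whose fidelities with the p_x φ^x add up to at least the fidelity of the sums. Each summand is
at most ω, so the block-diagonal operator built from them lies below (1/|Z|) 1 ⊗ σ. It is still
within ε of ρ, so its min-entropy is at least log |Z|. The same operator has trace at least 1 - ε²,
which bounds the extractable lengths and gives existence of the maximum.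

Lower bound. Take ρ' within ε - η of ρ with ρ' ≤ 2^t 1 ⊗ σ and hash with a uniformly random
function. A leftover hashing bound is proved directly for the fidelity
(`Protocol.le_fidelity_hashed_ideal`). Distinct inputs have uncorrelated hash values, so the second
moment of the deviation D from uniform, weighted by the inverse of an operator S that dominates
every block, is at most tr ρ'. Since ±D ≤ (c/2) S + (1/2c) D S⁻¹ D, a Powers–Størmer inequality
turns this into a fidelity bound without any absolute value of D. The triangle inequality for the
purified distance then returns from ρ' to ρ. -/

lemma trace_re_le_trace_re {A B : Matrix n n ℂ} (h : A ≤ B) : A.trace.re ≤ B.trace.re := by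
  have := (Complex.le_def.1 (Matrix.PosSemidef.trace_nonneg (Matrix.le_iff.1 h))).1
  rw [Matrix.trace_sub] at this
  simpa using this

lemma trace_re_nonneg {A : Matrix n n ℂ} (h : A.PosSemidef) : 0 ≤ A.trace.re :=
  (Complex.le_def.1 h.trace_nonneg).1

lemma conj_mono {A B : Matrix n n ℂ} (h : A ≤ B) (C : Matrix n m ℂ) : Cᴴ * A * C ≤ Cᴴ * B * C := by
  rw [Matrix.le_iff] at h ⊢
  convert h.conjTranspose_mul_mul_same C using 1
  rw [Matrix.mul_sub, Matrix.sub_mul]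

lemma conjTranspose_mul_self_le_of_contraction [DecidableEq n] {C : Matrix m n ℂ}
    (h : Cᴴ * C ≤ 1) {k : Type*} [Fintype k] (D : Matrix n k ℂ) :
    (C * D)ᴴ * (C * D) ≤ Dᴴ * D := by
  have := conj_mono h D
  simpa [Matrix.conjTranspose_mul, Matrix.mul_assoc] using this

/-- The real inner product `Re tr (a bᴴ)` on matrices. -/
def reInner (a b : Matrix m n ℂ) : ℝ := (a * bᴴ).trace.re

lemma reInner_comm (a b : Matrix m n ℂ) : reInner a b = reInner b a := by
  unfold reInner
  rw [← Complex.conj_re (b * aᴴ).trace]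
  congr 1
  rw [← Complex.star_def, ← Matrix.trace_conjTranspose]
  simp

lemma reInner_self (a : Matrix m n ℂ) : reInner a a = (aᴴ * a).trace.re := by
  rw [reInner, Matrix.trace_mul_comm]

lemma reInner_self_nonneg (a : Matrix m n ℂ) : 0 ≤ reInner a a := by
  rw [reInner_self]
  exact trace_re_nonneg (Matrix.posSemidef_conjTranspose_mul_self a)

lemma reInner_add_smul_left (a b c : Matrix m n ℂ) (t : ℝ) :
    reInner (a + t • b) c = reInner a c + t * reInner b c := by
  simp [reInner, Matrix.add_mul, Matrix.trace_add, Matrix.trace_smul]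

lemma reInner_add_smul_right (a b c : Matrix m n ℂ) (t : ℝ) :
    reInner c (a + t • b) = reInner c a + t * reInner c b := by
  rw [reInner_comm, reInner_add_smul_left, reInner_comm a, reInner_comm b]

lemma reInner_le_half (a b : Matrix m n ℂ) :
    reInner a b ≤ ((aᴴ * a).trace.re + (bᴴ * b).trace.re) / 2 := by
  have := reInner_self_nonneg (a + (-1 : ℝ) • b)
  rw [reInner_add_smul_left, reInner_add_smul_right, reInner_add_smul_right, reInner_comm b a] at this
  rw [← reInner_self, ← reInner_self]
  linarith

/-- The Cauchy–Schwarz inequality for `reInner`, with an additional real coordinate. -/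
lemma reInner_add_mul_sq_le (a b : Matrix m n ℂ) (r s : ℝ) :
    (reInner a b + r * s) ^ 2 ≤ (reInner a a + r ^ 2) * (reInner b b + s ^ 2) := by
  -- The squared norm of (a, r) + t (b, s) is a nonnegative quadratic in t, so its discriminant is
  -- not positive.
  have h : ∀ t : ℝ, 0 ≤ (reInner b b + s ^ 2) * (t * t) + (2 * (reInner a b + r * s)) * t
      + (reInner a a + r ^ 2) := by
    intro t
    have h1 := reInner_self_nonneg (a + t • b)
    rw [reInner_add_smul_left, reInner_add_smul_right, reInner_add_smul_right,
      reInner_comm b a] at h1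
    nlinarith [sq_nonneg (r + t * s)]
  have := discrim_le_zero h
  rw [discrim] at this
  linarith

/-- A Hermitian pseudo-inverse that commutes with a given positive semi-definite matrix. -/
lemma exists_pseudoinverse [DecidableEq n] {S : Matrix n n ℂ} (hS : S.PosSemidef) :
    ∃ Q : Matrix n n ℂ, Qᴴ = Q ∧ Q * S = S * Q ∧ S * Q * S = S := by
  have hsa : IsSelfAdjoint S := hS.1
  have hfin : (spectrum ℝ S).Finite := Matrix.finite_real_spectrum
  have hcont : ∀ f : ℝ → ℝ, ContinuousOn f (spectrum ℝ S) := fun f => hfin.continuousOn f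
  have hid : cfc (fun x : ℝ => x) S = S := cfc_id' ℝ S
  -- With 0⁻¹ = 0, the identity x x⁻¹ x = x holds on the whole spectrum.
  set Q := cfc (fun x : ℝ => x⁻¹) S with hQ
  have h1 : Q * S = cfc (fun x : ℝ => x⁻¹ * x) S := by
    rw [cfc_mul (fun x : ℝ => x⁻¹) (fun x => x) S (hcont _) (hcont _), hid]
  have h2 : S * Q = cfc (fun x : ℝ => x * x⁻¹) S := by
    rw [cfc_mul (fun x : ℝ => x) (fun x => x⁻¹) S (hcont _) (hcont _), hid]
  refine ⟨Q, (cfc_predicate (fun x : ℝ => x⁻¹) S : IsSelfAdjoint Q), ?_, ?_⟩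
  · rw [h1, h2]
    simp only [mul_comm]
  · have h3 : S * Q * S = cfc (fun x : ℝ => x * x⁻¹ * x) S := by
      rw [cfc_mul (fun x : ℝ => x * x⁻¹) (fun x => x) S (hcont _) (hcont _), hid, h2]
    rw [h3]
    simp only [mul_inv_mul_cancel, hid]

/-- Factorization with additional information: `C = V Q` for a pseudo-inverse `Q` of `S`. -/
lemma exists_contraction_factor [DecidableEq n] {S : Matrix n n ℂ} (hS : S.PosSemidef)
    {V : Matrix m n ℂ} (hV : Vᴴ * V ≤ S * S) :
    ∃ C : Matrix m n ℂ, C * S = V ∧ Cᴴ * C ≤ 1 ∧ (Vᴴ * V = S * S → Cᴴ * V = S) ∧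
      (Vᴴ * V = S * S → S * (Cᴴ * C) = S) := by
  obtain ⟨Q, hQ, hcomm, hSQS⟩ := exists_pseudoinverse hS
  have hSh : Sᴴ = S := hS.1
  have hPh : (S * Q)ᴴ = S * Q := by rw [conjTranspose_mul, hQ, hSh, hcomm]
  have hSPe : S * (1 - S * Q) = 0 := by
    rw [Matrix.mul_sub, Matrix.mul_one, ← hcomm, ← Matrix.mul_assoc, hSQS, sub_self]
  have hPP : S * Q * (S * Q) = S * Q := by rw [← Matrix.mul_assoc, hSQS]
  -- S Q is the support projection of S, and Vᴴ V ≤ S² forces V to vanish on the kernel of S.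
  have hV0 : V * (1 - S * Q) = 0 := by
    have h := conj_mono hV (1 - S * Q)
    rw [Matrix.mul_assoc _ (S * S), Matrix.mul_assoc S, hSPe] at h
    have h' : (V * (1 - S * Q))ᴴ * (V * (1 - S * Q)) ≤ 0 := by
      simpa [conjTranspose_mul, Matrix.mul_assoc] using h
    have h0 := le_antisymm h'
      (Matrix.nonneg_iff_posSemidef.2 (Matrix.posSemidef_conjTranspose_mul_self _))
    exact Matrix.conjTranspose_mul_self_eq_zero.1 h0
  have hVP : V * (S * Q) = V := by
    rw [Matrix.mul_sub, Matrix.mul_one, sub_eq_zero] at hV0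
    exact hV0.symm
  have hP1 : S * Q ≤ 1 := by
    rw [Matrix.le_iff]
    have : (1 - S * Q)ᴴ * (1 - S * Q) = 1 - S * Q := by
      rw [conjTranspose_sub, conjTranspose_one, hPh, Matrix.sub_mul, Matrix.mul_sub, Matrix.mul_sub,
        hPP]
      simp
    rw [← this]
    exact Matrix.posSemidef_conjTranspose_mul_self _
  refine ⟨V * Q, ?_, ?_, fun h => ?_, fun h => ?_⟩
  · rw [Matrix.mul_assoc, hcomm, hVP]
  · refine le_trans ?_ hP1
    have h := conj_mono hV Q
    have e1 : Qᴴ * (S * S) * Q = S * Q := by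
      rw [hQ, ← Matrix.mul_assoc, hcomm, Matrix.mul_assoc, hPP]
    rw [e1] at h
    simpa [conjTranspose_mul, Matrix.mul_assoc] using h
  · rw [conjTranspose_mul, Matrix.mul_assoc, h, hQ, ← Matrix.mul_assoc, hcomm, hSQS]
  · have : (V * Q)ᴴ * (V * Q) = S * Q := by
      rw [conjTranspose_mul, Matrix.mul_assoc, ← Matrix.mul_assoc Vᴴ, h, hQ, ← Matrix.mul_assoc,
        ← Matrix.mul_assoc, hcomm, hSQS]
    rw [this, ← hcomm, ← Matrix.mul_assoc, hSQS]

end MatrixFacts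

/-! ### Variational formula for the fidelity and its consequences -/

section RootFidelity

variable {m n : Type*} [Fintype m] [Fintype n] [DecidableEq n]

/-- The fidelity `tr |√A √B|`, without the correction for sub-normalized states. -/
def rootFid (A B : Matrix n n ℂ) : ℝ := (CFC.abs (CFC.sqrt A * CFC.sqrt B)).trace.re

lemma sqrt_posSemidef (A : Matrix n n ℂ) : (CFC.sqrt A).PosSemidef :=
  Matrix.nonneg_iff_posSemidef.1 (CFC.sqrt_nonneg A)

lemma sqrt_conjTranspose (A : Matrix n n ℂ) : (CFC.sqrt A)ᴴ = CFC.sqrt A := (sqrt_posSemidef A).1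

lemma sqrt_mul_sqrt {A : Matrix n n ℂ} (hA : A.PosSemidef) : CFC.sqrt A * CFC.sqrt A = A :=
  CFC.sqrt_mul_sqrt_self _ (Matrix.nonneg_iff_posSemidef.2 hA)

lemma abs_posSemidef (A : Matrix n n ℂ) : (CFC.abs A).PosSemidef :=
  Matrix.nonneg_iff_posSemidef.1 (CFC.abs_nonneg A)

/-- A polar decomposition with a contraction in place of a unitary, which suffices for all fidelity
estimates. -/
lemma exists_polar (T : Matrix n n ℂ) :
    ∃ U : Matrix n n ℂ, U * CFC.abs T = T ∧ Uᴴ * U ≤ 1 ∧ Uᴴ * T = CFC.abs T := by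
  have h : Tᴴ * T = CFC.abs T * CFC.abs T := (CFC.abs_mul_abs T).symm
  obtain ⟨U, h1, h2, h3, -⟩ := exists_contraction_factor (abs_posSemidef T) h.le
  exact ⟨U, h1, h2, h3 h⟩

lemma rootFid_nonneg (A B : Matrix n n ℂ) : 0 ≤ rootFid A B := trace_re_nonneg (abs_posSemidef _)

/-- Variational lower bound on the fidelity. -/
lemma reInner_le_rootFid {A B : Matrix n n ℂ} (hA : A.PosSemidef) (hB : B.PosSemidef)
    {a b : Matrix m n ℂ} (ha : aᴴ * a ≤ A) (hb : bᴴ * b ≤ B) : reInner a b ≤ rootFid A B := by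
  rw [← sqrt_mul_sqrt hA] at ha
  rw [← sqrt_mul_sqrt hB] at hb
  obtain ⟨K, hK, hK1, -⟩ := exists_contraction_factor (sqrt_posSemidef A) ha
  obtain ⟨L, hL, hL1, -⟩ := exists_contraction_factor (sqrt_posSemidef B) hb
  set T := CFC.sqrt A * CFC.sqrt B with hT
  obtain ⟨U, hU, hU1, -⟩ := exists_polar T
  set s := CFC.sqrt (CFC.abs T) with hs
  have hss : s * s = CFC.abs T := sqrt_mul_sqrt (abs_posSemidef T)
  have hsh : sᴴ = s := sqrt_conjTranspose _
  -- With a = K √A, b = L √B and √A √B = U s², the factor s² is shared between both sides. Each side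
  -- then has squared norm at most tr s² = tr |√A √B|.
  have e : reInner a b = reInner (K * (U * s)) (L * s) := by
    unfold reInner
    rw [← hK, ← hL]
    simp only [conjTranspose_mul, sqrt_conjTranspose, hsh]
    congr 2
    calc _ = K * T * Lᴴ := by rw [hT]; simp only [Matrix.mul_assoc]
      _ = _ := by rw [← hU, ← hss]; simp only [Matrix.mul_assoc]
  rw [e]
  refine (reInner_le_half _ _).trans ?_
  have h1 := trace_re_le_trace_re (conjTranspose_mul_self_le_of_contraction hK1 (U * s))
  have h2 := trace_re_le_trace_re (conjTranspose_mul_self_le_of_contraction hL1 s)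
  have h3 := trace_re_le_trace_re (conjTranspose_mul_self_le_of_contraction hU1 s)
  rw [hsh, hss] at h2 h3
  unfold rootFid
  linarith

/-- The variational lower bound is attained. -/
lemma exists_rootFid_eq_reInner {A B : Matrix n n ℂ} (hB : B.PosSemidef) :
    ∃ U : Matrix n n ℂ, Uᴴ * U ≤ 1 ∧ (U * CFC.sqrt B)ᴴ * (U * CFC.sqrt B) ≤ B ∧
      rootFid A B = reInner (CFC.sqrt A) (U * CFC.sqrt B) := by
  obtain ⟨U, -, hU1, hU⟩ := exists_polar (CFC.sqrt A * CFC.sqrt B)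
  refine ⟨U, hU1, ?_, ?_⟩
  · have := conjTranspose_mul_self_le_of_contraction hU1 (CFC.sqrt B)
    rwa [sqrt_conjTranspose, sqrt_mul_sqrt hB] at this
  · rw [rootFid, ← hU, reInner, conjTranspose_mul, sqrt_conjTranspose, Matrix.trace_mul_comm,
      Matrix.mul_assoc]

lemma sqrt_conjTranspose_mul_sqrt {A : Matrix n n ℂ} (hA : A.PosSemidef) :
    (CFC.sqrt A)ᴴ * CFC.sqrt A = A := by
  rw [sqrt_conjTranspose, sqrt_mul_sqrt hA]

lemma exists_rootFid_eq {A B : Matrix n n ℂ} (hA : A.PosSemidef) (hB : B.PosSemidef) :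
    ∃ a b : Matrix n n ℂ, aᴴ * a = A ∧ bᴴ * b ≤ B ∧ rootFid A B = reInner a b := by
  obtain ⟨U, -, h1, h2⟩ := exists_rootFid_eq_reInner (A := A) hB
  exact ⟨_, _, sqrt_conjTranspose_mul_sqrt hA, h1, h2⟩

lemma rootFid_comm {A B : Matrix n n ℂ} (hA : A.PosSemidef) (hB : B.PosSemidef) :
    rootFid A B = rootFid B A := by
  apply le_antisymm
  · obtain ⟨a, b, ha, hb, h⟩ := exists_rootFid_eq hA hB
    rw [h, reInner_comm]
    exact reInner_le_rootFid hB hA hb ha.le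
  · obtain ⟨a, b, ha, hb, h⟩ := exists_rootFid_eq hB hA
    rw [h, reInner_comm]
    exact reInner_le_rootFid hA hB hb ha.le

lemma rootFid_mono {A B A' B' : Matrix n n ℂ} (hA : A.PosSemidef) (hB : B.PosSemidef)
    (hA' : A ≤ A') (hB' : B ≤ B') : rootFid A B ≤ rootFid A' B' := by
  obtain ⟨a, b, ha, hb, h⟩ := exists_rootFid_eq hA hB
  rw [h]
  have e : ∀ {C D : Matrix n n ℂ}, C.PosSemidef → C ≤ D → D.PosSemidef := fun h1 h2 =>
    Matrix.nonneg_iff_posSemidef.1 ((Matrix.nonneg_iff_posSemidef.2 h1).trans h2)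
  exact reInner_le_rootFid (e hA hA') (e hB hB') (ha.le.trans hA') (hb.trans hB')

lemma rootFid_sq_le {A B : Matrix n n ℂ} (hA : A.PosSemidef) (hB : B.PosSemidef) :
    rootFid A B ^ 2 ≤ A.trace.re * B.trace.re := by
  obtain ⟨a, b, ha, hb, h⟩ := exists_rootFid_eq hA hB
  have := reInner_add_mul_sq_le a b 0 0
  simp only [mul_zero, add_zero, ne_eq, OfNat.ofNat_ne_zero, not_false_eq_true, zero_pow,
    reInner_self, ha] at this
  rw [h]
  exact this.trans (mul_le_mul_of_nonneg_left (trace_re_le_trace_re hb) (trace_re_nonneg hA))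

lemma trace_re_le_rootFid_self {A : Matrix n n ℂ} (hA : A.PosSemidef) :
    A.trace.re ≤ rootFid A A := by
  have h := sqrt_conjTranspose_mul_sqrt hA
  refine le_trans ?_ (reInner_le_rootFid hA hA h.le h.le)
  rw [reInner_self, h]

lemma smul_posSemidef {A : Matrix n n ℂ} (hA : A.PosSemidef) {c : ℝ} (hc : 0 ≤ c) :
    (c • A).PosSemidef := hA.smul hc

lemma smul_mono {A B : Matrix n n ℂ} (h : A ≤ B) {c : ℝ} (hc : 0 ≤ c) : c • A ≤ c • B := by
  rw [Matrix.le_iff] at h ⊢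
  rw [← smul_sub]
  exact smul_posSemidef h hc

lemma mul_rootFid_le {A B : Matrix n n ℂ} (hA : A.PosSemidef) (hB : B.PosSemidef) (c d : ℝ) :
    c * d * rootFid A B ≤ rootFid ((c ^ 2) • A) ((d ^ 2) • B) := by
  obtain ⟨a, b, ha, hb, h⟩ := exists_rootFid_eq hA hB
  have e1 : (c • a)ᴴ * (c • a) = (c ^ 2) • A := by
    rw [← ha, conjTranspose_smul, Matrix.smul_mul, Matrix.mul_smul, smul_smul]
    simp [sq]
  have e2 : (d • b)ᴴ * (d • b) ≤ (d ^ 2) • B := by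
    rw [conjTranspose_smul, Matrix.smul_mul, Matrix.mul_smul, smul_smul]
    simpa [sq] using smul_mono hb (sq_nonneg d)
  refine le_trans (le_of_eq ?_) (reInner_le_rootFid (smul_posSemidef hA (sq_nonneg c))
    (smul_posSemidef hB (sq_nonneg d)) e1.le e2)
  rw [h]
  simp [reInner, conjTranspose_smul, Matrix.trace_smul]
  ring

lemma rootFid_zero_left (B : Matrix n n ℂ) : rootFid 0 B = 0 := by
  simp [rootFid]

lemma rootFid_smul_smul {A B : Matrix n n ℂ} (hA : A.PosSemidef) (hB : B.PosSemidef) {c : ℝ}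
    (hc : 0 ≤ c) : rootFid (c • A) (c • B) = c * rootFid A B := by
  rcases hc.eq_or_lt with rfl | hc0
  · simp [rootFid_zero_left]
  have key : ∀ {A B : Matrix n n ℂ}, A.PosSemidef → B.PosSemidef → ∀ c : ℝ, 0 ≤ c →
      c * rootFid A B ≤ rootFid (c • A) (c • B) := by
    intro A B hA hB c hc
    have h := mul_rootFid_le hA hB √c √c
    rwa [Real.sq_sqrt hc, Real.mul_self_sqrt hc] at h
  refine le_antisymm ?_ (key hA hB c hc)
  -- The reverse inequality is the same one applied to the scaled operators with factor c⁻¹.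
  have h := key (smul_posSemidef hA hc) (smul_posSemidef hB hc) c⁻¹ (by positivity)
  rw [smul_smul, smul_smul, inv_mul_cancel₀ hc0.ne', one_smul, one_smul] at h
  rwa [inv_mul_le_iff₀ hc0] at h

end RootFidelity

/-! ### Triangle inequality for the purified distance -/

section Triangle

variable {n : Type*} [Fintype n] [DecidableEq n]

lemma fidelity_eq (ρ σ : Matrix n n ℂ) :
    fidelity ρ σ = rootFid ρ σ + √((1 - ρ.trace.re) * (1 - σ.trace.re)) := rfl

lemma fidelity_nonneg (ρ σ : Matrix n n ℂ) : 0 ≤ fidelity ρ σ :=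
  add_nonneg (rootFid_nonneg _ _) (Real.sqrt_nonneg _)

lemma fidelity_comm {ρ σ : Matrix n n ℂ} (hρ : ρ.PosSemidef) (hσ : σ.PosSemidef) :
    fidelity ρ σ = fidelity σ ρ := by
  rw [fidelity_eq, fidelity_eq, rootFid_comm hρ hσ, mul_comm]

lemma fidelity_of_trace_eq_one {ρ : Matrix n n ℂ} (hρ : ρ.trace = 1) (σ : Matrix n n ℂ) :
    fidelity ρ σ = rootFid ρ σ := by
  rw [fidelity_eq, hρ]
  simp

/-- The triangle inequality for the angle `arccos F`, in terms of cosines. -/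
lemma fidelity_triangle {ρ τ σ : Matrix n n ℂ} (hρ : ρ.PosSemidef) (hτ : τ.PosSemidef)
    (hσ : σ.PosSemidef) (hρ1 : ρ.trace.re ≤ 1) (hτ1 : τ.trace.re ≤ 1) (hσ1 : σ.trace.re ≤ 1) :
    fidelity ρ τ * fidelity τ σ - √(1 - fidelity ρ τ ^ 2) * √(1 - fidelity τ σ ^ 2) ≤
      fidelity ρ σ := by
  -- Both fidelities with τ are attained with the same b = √τ. The missing traces become an extra
  -- real coordinate, so (b, t) is a unit vector while (a, r) and (c, s) have norm at most one.
  obtain ⟨U, -, ha, hab⟩ := exists_rootFid_eq_reInner (A := τ) hρ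
  obtain ⟨V, -, hc, hbc⟩ := exists_rootFid_eq_reInner (A := τ) hσ
  set a := U * CFC.sqrt ρ
  set c := V * CFC.sqrt σ
  set b := CFC.sqrt τ with hb
  have hbb : reInner b b = τ.trace.re := by rw [reInner_self, sqrt_conjTranspose_mul_sqrt hτ]
  have haa : reInner a a ≤ ρ.trace.re := by
    rw [reInner_self]
    exact trace_re_le_trace_re ha
  have hcc : reInner c c ≤ σ.trace.re := by
    rw [reInner_self]
    exact trace_re_le_trace_re hc
  have hac : reInner a c ≤ rootFid ρ σ := reInner_le_rootFid hρ hσ ha hc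
  set r := √(1 - ρ.trace.re) with hr
  set t := √(1 - τ.trace.re) with ht
  set s := √(1 - σ.trace.re) with hs
  have hr2 : r ^ 2 = 1 - ρ.trace.re := Real.sq_sqrt (by linarith)
  have ht2 : t ^ 2 = 1 - τ.trace.re := Real.sq_sqrt (by linarith)
  have hs2 : s ^ 2 = 1 - σ.trace.re := Real.sq_sqrt (by linarith)
  have hf : fidelity ρ τ = reInner a b + r * t := by
    rw [fidelity_eq, rootFid_comm hρ hτ, hab, reInner_comm, Real.sqrt_mul (by linarith)]
  have hg : fidelity τ σ = reInner b c + t * s := by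
    rw [fidelity_eq, hbc, Real.sqrt_mul (by linarith)]
  have hh : reInner a c + r * s ≤ fidelity ρ σ := by
    rw [fidelity_eq, Real.sqrt_mul (by linarith)]
    linarith
  generalize fidelity ρ τ = f at *
  generalize fidelity τ σ = g at *
  -- Cauchy–Schwarz for the components of (a, r) and (c, s) orthogonal to (b, t), whose squared
  -- norms are at most 1 - f² and 1 - g².
  have key := reInner_add_mul_sq_le (a + (-f) • b) (c + (-g) • b) (r - f * t) (s - g * t)
  simp only [reInner_add_smul_left, reInner_add_smul_right, hbb] at key
  rw [reInner_comm b a, reInner_comm c b] at key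
  set A := reInner a b
  set C := reInner b c
  have e1 : reInner a c + -f * C + -g * (A + -f * τ.trace.re) + (r - f * t) * (s - g * t)
      = reInner a c + r * s - f * g := by
    linear_combination g * hf + f * hg + f * g * ht2
  have e2 : reInner a a + -f * A + -f * (A + -f * τ.trace.re) + (r - f * t) ^ 2 ≤ 1 - f ^ 2 := by
    linear_combination haa + hr2 + 2 * f * hf + f ^ 2 * ht2
  have e3 : reInner c c + -g * C + -g * (C + -g * τ.trace.re) + (s - g * t) ^ 2 ≤ 1 - g ^ 2 := by
    linear_combination hcc + hs2 + 2 * g * hg + g ^ 2 * ht2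
  have e4 : 0 ≤ reInner a a + -f * A + -f * (A + -f * τ.trace.re) + (r - f * t) ^ 2 := by
    have := reInner_self_nonneg (a + (-f) • b)
    simp only [reInner_add_smul_left, reInner_add_smul_right, hbb] at this
    rw [reInner_comm b a] at this
    positivity
  have e5 : 0 ≤ reInner c c + -g * C + -g * (C + -g * τ.trace.re) + (s - g * t) ^ 2 := by
    have := reInner_self_nonneg (c + (-g) • b)
    simp only [reInner_add_smul_left, reInner_add_smul_right, hbb] at this
    rw [reInner_comm c b] at this
    positivity
  have e6 : (reInner a c + r * s - f * g) ^ 2 ≤ (1 - f ^ 2) * (1 - g ^ 2) := by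
    rw [← e1]
    exact key.trans (mul_le_mul e2 e3 e5 (e4.trans e2))
  have e7 := Real.abs_le_sqrt e6
  rw [Real.sqrt_mul (e4.trans e2)] at e7
  linarith [neg_abs_le (reInner a c + r * s - f * g)]

lemma purifiedDistance_nonneg (ρ σ : Matrix n n ℂ) : 0 ≤ purifiedDistance ρ σ := Real.sqrt_nonneg _

lemma purifiedDistance_le_iff {ρ σ : Matrix n n ℂ} {ε : ℝ} (hε : 0 ≤ ε) :
    purifiedDistance ρ σ ≤ ε ↔ 1 - ε ^ 2 ≤ fidelity ρ σ ^ 2 := by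
  rw [purifiedDistance, Real.sqrt_le_left hε]
  constructor <;> intro h <;> linarith

lemma purifiedDistance_triangle {ρ τ σ : Matrix n n ℂ} (hρ : ρ.PosSemidef) (hτ : τ.PosSemidef)
    (hσ : σ.PosSemidef) (hρ1 : ρ.trace.re ≤ 1) (hτ1 : τ.trace.re ≤ 1) (hσ1 : σ.trace.re ≤ 1) :
    purifiedDistance ρ σ ≤ purifiedDistance ρ τ + purifiedDistance τ σ := by
  have key := fidelity_triangle hρ hτ hσ hρ1 hτ1 hσ1
  have hp := purifiedDistance_nonneg ρ τ
  have hq := purifiedDistance_nonneg τ σ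
  have hpf : 1 - purifiedDistance ρ τ ^ 2 ≤ fidelity ρ τ ^ 2 :=
    (purifiedDistance_le_iff hp).1 le_rfl
  have hqf : 1 - purifiedDistance τ σ ^ 2 ≤ fidelity τ σ ^ 2 :=
    (purifiedDistance_le_iff hq).1 le_rfl
  rw [purifiedDistance_le_iff (by positivity)]
  change _ - purifiedDistance ρ τ * purifiedDistance τ σ ≤ _ at key
  have hf0 := fidelity_nonneg ρ τ
  have hg0 := fidelity_nonneg τ σ
  have hh0 := fidelity_nonneg ρ σ
  generalize purifiedDistance ρ τ = p at *
  generalize purifiedDistance τ σ = q at *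
  generalize fidelity ρ τ = f at *
  generalize fidelity τ σ = g at *
  generalize fidelity ρ σ = h at *
  rcases le_or_gt 1 (p + q) with h1 | h1
  · nlinarith
  set w := √(1 - (p + q) ^ 2)
  have hw0 : 0 ≤ w := Real.sqrt_nonneg _
  have hw2 : w ^ 2 = 1 - (p + q) ^ 2 := Real.sq_sqrt (by nlinarith)
  have hw1 : w ≤ 1 := by nlinarith [sq_nonneg (p + q)]
  -- After squaring and inserting w² = 1 - (p + q)², the claim reduces to 2pqw ≤ 2pq.
  have hpq : p * q + w ≤ f * g := by
    apply le_of_sq_le_sq _ (by positivity)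
    have h2 : (1 - p ^ 2) * (1 - q ^ 2) ≤ f ^ 2 * g ^ 2 :=
      mul_le_mul hpf hqf (by nlinarith) (by positivity)
    nlinarith [mul_nonneg (mul_nonneg hp hq) (sub_nonneg.2 hw1)]
  nlinarith

lemma purifiedDistance_comm {ρ σ : Matrix n n ℂ} (hρ : ρ.PosSemidef) (hσ : σ.PosSemidef) :
    purifiedDistance ρ σ = purifiedDistance σ ρ := by
  rw [purifiedDistance, purifiedDistance, fidelity_comm hρ hσ]

end Triangle

/-! ### Splitting an operator along a given decomposition -/

section Extension

variable {n : Type*} [Fintype n] [DecidableEq n]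

/-- If `A = ∑ A_i`, then every `ω` dominates a sum `∑ ω_i` such that the fidelities of `A_i` and
`ω_i` add up to at least the fidelity of `A` and `ω`. -/
lemma exists_extension {ι : Type*} (s : Finset ι) {A : ι → Matrix n n ℂ}
    (hA : ∀ i, (A i).PosSemidef) {ω : Matrix n n ℂ} (hω : ω.PosSemidef) :
    ∃ W : ι → Matrix n n ℂ, (∀ i, (W i).PosSemidef) ∧ ∑ i ∈ s, W i ≤ ω ∧
      rootFid (∑ i ∈ s, A i) ω ≤ ∑ i ∈ s, rootFid (A i) (W i) := by
  classical
  set S := ∑ i ∈ s, A i with hS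
  have hSp : S.PosSemidef := Matrix.posSemidef_sum s fun i _ => hA i
  obtain ⟨U, hU1, hU2, hF⟩ := exists_rootFid_eq_reInner (A := S) hω
  set R := CFC.sqrt S with hR
  have hRR : R * R = S := sqrt_mul_sqrt hSp
  have hRh : Rᴴ = R := sqrt_conjTranspose _
  set b := U * CFC.sqrt ω with hb
  -- Stacking the √A_i gives Vᴴ V = S, so V = C √S. The blocks K_i of C satisfy K_i √S = √A_i and ∑
  -- K_iᴴ K_i ≤ 1: they form a measurement of the purifying side that splits S into the A_i. The
  -- same measurement applied to b, which is optimal for ω, yields the W_i.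
  let V : Matrix (s × n) n ℂ := Matrix.of fun p j => CFC.sqrt (A p.1) p.2 j
  have hV : Vᴴ * V = R * R := by
    rw [hRR, hS, ← Finset.sum_coe_sort]
    ext j k
    rw [Matrix.mul_apply, Fintype.sum_prod_type, Matrix.sum_apply]
    refine Finset.sum_congr rfl fun i _ => ?_
    conv_rhs => rw [← sqrt_conjTranspose_mul_sqrt (hA i), Matrix.mul_apply]
    rfl
  obtain ⟨C, hCR, hC1, -, hCC⟩ := exists_contraction_factor (sqrt_posSemidef S) hV.le
  let K : ι → Matrix n n ℂ := fun i =>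
    if h : i ∈ s then Matrix.of fun j k => C (⟨i, h⟩, j) k else 0
  have hK : ∀ i ∈ s, K i * R = CFC.sqrt (A i) := by
    intro i hi
    ext j k
    have := congrFun (congrFun hCR (⟨i, hi⟩, j)) k
    simpa [K, hi, Matrix.mul_apply, V] using this
  have hKsum : ∑ i ∈ s, (K i)ᴴ * K i = Cᴴ * C := by
    rw [← Finset.sum_coe_sort]
    ext j k
    rw [Matrix.mul_apply, Fintype.sum_prod_type, Matrix.sum_apply]
    refine Finset.sum_congr rfl fun i _ => ?_
    simp [K, Matrix.mul_apply]
  refine ⟨fun i => (K i * b)ᴴ * (K i * b), fun i => posSemidef_conjTranspose_mul_self _, ?_, ?_⟩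
  · have : ∑ i ∈ s, (K i * b)ᴴ * (K i * b) = (C * b)ᴴ * (C * b) := by
      rw [conjTranspose_mul, Matrix.mul_assoc, ← Matrix.mul_assoc Cᴴ, ← hKsum, Finset.sum_mul,
        Finset.mul_sum]
      simp only [conjTranspose_mul, Matrix.mul_assoc]
    rw [this]
    exact (conjTranspose_mul_self_le_of_contraction hC1 b).trans hU2
  · have hle : ∀ i ∈ s, reInner (CFC.sqrt (A i)) (K i * b) ≤
        rootFid (A i) ((K i * b)ᴴ * (K i * b)) := fun i _ =>
      reInner_le_rootFid (hA i) (posSemidef_conjTranspose_mul_self _)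
        (sqrt_conjTranspose_mul_sqrt (hA i)).le le_rfl
    refine le_trans (le_of_eq ?_) (Finset.sum_le_sum hle)
    rw [hF]
    have e : ∀ i ∈ s, reInner (CFC.sqrt (A i)) (K i * b) = ((K i)ᴴ * K i * (R * bᴴ)).trace.re := by
      intro i hi
      rw [reInner, ← hK i hi, conjTranspose_mul, Matrix.mul_assoc (K i), ← Matrix.mul_assoc R,
        Matrix.trace_mul_comm, Matrix.mul_assoc (R * bᴴ), Matrix.trace_mul_comm]
    -- Cᴴ C acts as the identity on the range of R, so nothing is lost when the inner products are
    -- summed.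
    have hCR' : Cᴴ * C * R = R := by
      have := congrArg conjTranspose (hCC hV)
      rwa [conjTranspose_mul, conjTranspose_mul, conjTranspose_conjTranspose, hRh] at this
    rw [Finset.sum_congr rfl e, ← Complex.re_sum, ← Matrix.trace_sum, ← Finset.sum_mul, hKsum,
      ← Matrix.mul_assoc, hCR', reInner]

end Extension

/-! ### A Powers–Størmer inequality -/

section PowersStormer

variable {n : Type*} [Fintype n] [DecidableEq n]

lemma trace_re_mul_nonneg {A B : Matrix n n ℂ} (hA : A.PosSemidef) (hB : B.PosSemidef) :
    0 ≤ (A * B).trace.re := by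
  have : (A * B).trace = (CFC.sqrt A * B * (CFC.sqrt A)ᴴ).trace := by
    rw [sqrt_conjTranspose, Matrix.trace_mul_comm (CFC.sqrt A * B), ← Matrix.mul_assoc,
      sqrt_mul_sqrt hA]
  rw [this]
  exact trace_re_nonneg (hB.mul_mul_conjTranspose_same _)

open scoped Matrix.Norms.L2Operator in
lemma sqrt_mono {A B : Matrix n n ℂ} (h : A ≤ B) : CFC.sqrt A ≤ CFC.sqrt B :=
  CFC.sqrt_le_sqrt _ _ h

lemma trace_re_sqrt_mul_sqrt_le_rootFid {A B : Matrix n n ℂ} (hA : A.PosSemidef)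
    (hB : B.PosSemidef) : (CFC.sqrt A * CFC.sqrt B).trace.re ≤ rootFid A B := by
  have := reInner_le_rootFid hA hB (sqrt_conjTranspose_mul_sqrt hA).le
    (sqrt_conjTranspose_mul_sqrt hB).le
  rwa [reInner, sqrt_conjTranspose] at this

/-- A form of the Powers–Størmer inequality. -/
lemma powers_stormer {A B N : Matrix n n ℂ} (hA : A.PosSemidef) (hB : B.PosSemidef)
    (h1 : A - B ≤ N) (h2 : B - A ≤ N) :
    (A.trace.re + B.trace.re - N.trace.re) / 2 ≤ rootFid A B := by
  -- M is a common upper bound of A and B; when N = |A - B| it is A plus the positive part of B - A.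
  set M := (1 / 2 : ℝ) • (A + B + N) with hM
  have hAM : A ≤ M := by
    have := smul_mono (sub_nonneg.2 h1) (c := 1 / 2) (by norm_num)
    rw [smul_zero] at this
    rw [← sub_nonneg]
    convert this using 1
    rw [hM]
    module
  have hBM : B ≤ M := by
    have := smul_mono (sub_nonneg.2 h2) (c := 1 / 2) (by norm_num)
    rw [smul_zero] at this
    rw [← sub_nonneg]
    convert this using 1
    rw [hM]
    module
  have hMp : M.PosSemidef := Matrix.nonneg_iff_posSemidef.1
    ((Matrix.nonneg_iff_posSemidef.2 hA).trans hAM)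
  refine le_trans ?_ (trace_re_sqrt_mul_sqrt_le_rootFid hA hB)
  have hMt : M.trace.re = (A.trace.re + B.trace.re + N.trace.re) / 2 := by
    rw [hM, Matrix.trace_smul, Matrix.trace_add, Matrix.trace_add]
    simp
    ring
  have hAs := sqrt_mul_sqrt hA
  have hBs := sqrt_mul_sqrt hB
  have hMs := sqrt_mul_sqrt hMp
  have hA0 := sqrt_posSemidef A
  have hB0 := sqrt_posSemidef B
  have hM0 := sqrt_posSemidef M
  have hAMs : (CFC.sqrt M - CFC.sqrt A).PosSemidef := sqrt_mono hAM
  have hBMs : (CFC.sqrt M - CFC.sqrt B).PosSemidef := sqrt_mono hBM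
  -- By operator monotonicity √M dominates √A and √B. The three nonnegative traces add up to tr √A
  -- √B ≥ tr A + tr B - tr M.
  have i1 := trace_re_mul_nonneg hA0 hAMs
  have i2 := trace_re_mul_nonneg hAMs hBMs
  have i3 := trace_re_mul_nonneg hBMs hB0
  simp only [Matrix.mul_sub, Matrix.sub_mul, Matrix.trace_sub, Complex.sub_re, hAs, hBs, hMs] at i1 i2 i3
  linarith

end PowersStormer

/-! ### Superadditivity of the fidelity -/

section Superadditivity

variable {n : Type*} [Fintype n] [DecidableEq n]

/-- Stacking optimal a over a' and b over b' adds both the Gram matrices and the inner products. -/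
lemma rootFid_add_le {A B A' B' : Matrix n n ℂ} (hA : A.PosSemidef) (hB : B.PosSemidef)
    (hA' : A'.PosSemidef) (hB' : B'.PosSemidef) :
    rootFid A B + rootFid A' B' ≤ rootFid (A + A') (B + B') := by
  obtain ⟨a, b, ha, hb, h⟩ := exists_rootFid_eq hA hB
  obtain ⟨a', b', ha', hb', h'⟩ := exists_rootFid_eq hA' hB'
  have key : ∀ c c' : Matrix n n ℂ,
      (Matrix.fromRows c c')ᴴ * Matrix.fromRows c c' = cᴴ * c + c'ᴴ * c' := fun c c' => by
    rw [conjTranspose_fromRows_eq_fromCols_conjTranspose, fromCols_mul_fromRows]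
  have hr : reInner (Matrix.fromRows a a') (Matrix.fromRows b b') =
      reInner a b + reInner a' b' := by
    rw [reInner, conjTranspose_fromRows_eq_fromCols_conjTranspose, fromRows_mul_fromCols]
    simp [Matrix.trace, reInner]
  rw [h, h', ← hr]
  refine reInner_le_rootFid (hA.add hA') (hB.add hB') ?_ ?_
  · rw [key, ha, ha']
  · rw [key]
    exact add_le_add hb hb'

lemma sum_rootFid_le {ι : Type*} (s : Finset ι) {A B : ι → Matrix n n ℂ}
    (hA : ∀ i, (A i).PosSemidef) (hB : ∀ i, (B i).PosSemidef) :
    ∑ i ∈ s, rootFid (A i) (B i) ≤ rootFid (∑ i ∈ s, A i) (∑ i ∈ s, B i) := by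
  classical
  induction s using Finset.induction_on with
  | empty => simp [rootFid_zero_left]
  | insert i s hi ih =>
    rw [Finset.sum_insert hi, Finset.sum_insert hi, Finset.sum_insert hi]
    exact (add_le_add_right ih _).trans (rootFid_add_le (hA i) (hB i)
      (Matrix.posSemidef_sum s fun i _ => hA i) (Matrix.posSemidef_sum s fun i _ => hB i))

end Superadditivity

/-! ### Block-diagonal operators -/

section Blocks

variable {ι k n : Type*} [Fintype ι] [DecidableEq ι] [Fintype k] [Fintype n]

/-- The block-diagonal matrix with blocks `A i`, on an index set identified with `k × ι`. -/
def blocks (e : k × ι ≃ n) (A : ι → Matrix k k ℂ) : Matrix n n ℂ :=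
  (Matrix.blockDiagonal A).submatrix e.symm e.symm

lemma blocks_apply (e : k × ι ≃ n) (A : ι → Matrix k k ℂ) (x y : n) :
    blocks e A x y = if (e.symm x).2 = (e.symm y).2 then
      A (e.symm x).2 (e.symm x).1 (e.symm y).1 else 0 := by
  simp [blocks, Matrix.blockDiagonal_apply]

lemma blocks_conjTranspose_mul (e : k × ι ≃ n) (A : ι → Matrix k k ℂ) :
    (blocks e A)ᴴ * blocks e A = blocks e fun i => (A i)ᴴ * A i := by
  rw [blocks, conjTranspose_submatrix, blockDiagonal_conjTranspose, submatrix_mul_equiv, blocks,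
    blockDiagonal_mul]

lemma blocks_mul_conjTranspose (e : k × ι ≃ n) (A B : ι → Matrix k k ℂ) :
    blocks e A * (blocks e B)ᴴ = blocks e fun i => A i * (B i)ᴴ := by
  rw [blocks, blocks, conjTranspose_submatrix, blockDiagonal_conjTranspose, submatrix_mul_equiv,
    blocks, blockDiagonal_mul]

lemma trace_blocks (e : k × ι ≃ n) (A : ι → Matrix k k ℂ) :
    (blocks e A).trace = ∑ i, (A i).trace := by
  rw [blocks, Matrix.trace, ← trace_blockDiagonal, Matrix.trace]
  exact Equiv.sum_comp e.symm fun i => (Matrix.blockDiagonal A) i i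

lemma blocks_posSemidef [DecidableEq k] (e : k × ι ≃ n) {A : ι → Matrix k k ℂ}
    (hA : ∀ i, (A i).PosSemidef) : (blocks e A).PosSemidef := by
  have : A = fun i => (CFC.sqrt (A i))ᴴ * CFC.sqrt (A i) :=
    funext fun i => (sqrt_conjTranspose_mul_sqrt (hA i)).symm
  rw [this, ← blocks_conjTranspose_mul]
  exact posSemidef_conjTranspose_mul_self _

lemma blocks_mono [DecidableEq k] (e : k × ι ≃ n) {A B : ι → Matrix k k ℂ}
    (h : ∀ i, A i ≤ B i) : blocks e A ≤ blocks e B := by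
  rw [Matrix.le_iff]
  have : blocks e B - blocks e A = blocks e fun i => B i - A i := by
    ext x y
    simp only [Matrix.sub_apply, blocks_apply]
    split_ifs <;> simp
  rw [this]
  exact blocks_posSemidef e fun i => Matrix.le_iff.1 (h i)

/-- Pinching does not decrease the fidelity: the inner product of optimal a and b splits over groups
of columns, and the Gram matrices of these groups are the diagonal blocks. -/
lemma rootFid_le_sum [DecidableEq k] [DecidableEq n] (e : k × ι ≃ n) {M N : Matrix n n ℂ}
    (hM : M.PosSemidef) (hN : N.PosSemidef) :
    rootFid M N ≤ ∑ i, rootFid (M.submatrix (fun b => e (b, i)) (fun b => e (b, i)))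
      (N.submatrix (fun b => e (b, i)) (fun b => e (b, i))) := by
  obtain ⟨a, b, ha, hb, h⟩ := exists_rootFid_eq hM hN
  have hr : reInner a b = ∑ i, reInner (a.submatrix id fun c => e (c, i))
      (b.submatrix id fun c => e (c, i)) := by
    unfold reInner
    rw [← Complex.re_sum]
    congr 1
    simp only [Matrix.trace, Matrix.diag, Matrix.mul_apply, submatrix_apply, conjTranspose_apply, id]
    conv_rhs => rw [Finset.sum_comm]
    refine Finset.sum_congr rfl fun j _ => ?_
    rw [← Equiv.sum_comp e, Fintype.sum_prod_type_right]
  have hsub : ∀ (c : Matrix n n ℂ) i, (c.submatrix id fun d => e (d, i))ᴴ *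
      (c.submatrix id fun d => e (d, i)) =
      (cᴴ * c).submatrix (fun d => e (d, i)) (fun d => e (d, i)) := fun c i => by
    ext x y
    simp [Matrix.mul_apply]
  rw [h, hr]
  refine Finset.sum_le_sum fun i _ => reInner_le_rootFid (hM.submatrix _) (hN.submatrix _) ?_ ?_
  · rw [hsub, ha]
  · rw [hsub, Matrix.le_iff]
    exact (Matrix.le_iff.1 hb).submatrix _

lemma blocks_submatrix (e : k × ι ≃ n) (A : ι → Matrix k k ℂ) (i : ι) :
    (blocks e A).submatrix (fun b => e (b, i)) (fun b => e (b, i)) = A i := by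
  ext x y
  simp [blocks_apply]

lemma rootFid_blocks [DecidableEq k] [DecidableEq n] (e : k × ι ≃ n) {A B : ι → Matrix k k ℂ}
    (hA : ∀ i, (A i).PosSemidef) (hB : ∀ i, (B i).PosSemidef) :
    rootFid (blocks e A) (blocks e B) = ∑ i, rootFid (A i) (B i) := by
  apply le_antisymm
  · have := rootFid_le_sum e (blocks_posSemidef e hA) (blocks_posSemidef e hB)
    simpa only [blocks_submatrix] using this
  · choose a b ha hb h using fun i => exists_rootFid_eq (hA i) (hB i)
    have : ∑ i, rootFid (A i) (B i) = reInner (blocks e a) (blocks e b) := by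
      rw [reInner, blocks_mul_conjTranspose, trace_blocks, Complex.re_sum]
      exact Finset.sum_congr rfl fun i _ => h i
    rw [this]
    refine reInner_le_rootFid (blocks_posSemidef e hA) (blocks_posSemidef e hB) ?_ ?_
    · rw [blocks_conjTranspose_mul]
      exact blocks_mono e fun i => (ha i).le
    · rw [blocks_conjTranspose_mul]
      exact blocks_mono e hb

end Blocks

/-! ### Attainment of the optimal side-information state -/

section Compactness

variable {m n : Type*} [Fintype m] [Fintype n]

lemma isClosed_posSemidef : IsClosed {A : Matrix n n ℂ | A.PosSemidef} := by
  have : {A : Matrix n n ℂ | A.PosSemidef} =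
      {A | Aᴴ = A} ∩ ⋂ x : n → ℂ, {A | 0 ≤ star x ⬝ᵥ (A *ᵥ x)} := by
    ext A
    simp [posSemidef_iff_dotProduct_mulVec, Matrix.IsHermitian]
  rw [this]
  refine (isClosed_eq (by fun_prop) continuous_id).inter (isClosed_iInter fun x => ?_)
  exact isClosed_le continuous_const (by fun_prop)

lemma norm_sq_le_reInner (a : Matrix m n ℂ) (i : m) (j : n) : ‖a i j‖ ^ 2 ≤ reInner a a := by
  have : reInner a a = ∑ i, ∑ j, ‖a i j‖ ^ 2 := by
    simp [reInner, Matrix.trace, Matrix.mul_apply, Complex.mul_conj, Complex.normSq_eq_norm_sq]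
    norm_cast
  rw [this]
  refine le_trans ?_ (Finset.single_le_sum (fun i _ => Finset.sum_nonneg fun j _ => sq_nonneg ‖a i j‖)
    (Finset.mem_univ i))
  exact Finset.single_le_sum (f := fun j => ‖a i j‖ ^ 2) (fun j _ => sq_nonneg ‖a i j‖)
    (Finset.mem_univ j)

lemma continuous_reInner_self : Continuous fun a : Matrix m n ℂ => reInner a a := by
  unfold reInner
  fun_prop

lemma isCompact_reInner_self_le : IsCompact {a : Matrix m n ℂ | reInner a a ≤ 1} := by
  have hb : IsCompact (Set.univ.pi fun _ : m => Set.univ.pi fun _ : n => Metric.closedBall (0 : ℂ) 1) :=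
    isCompact_univ_pi fun _ => isCompact_univ_pi fun _ => isCompact_closedBall _ _
  refine IsCompact.of_isClosed_subset (X := Matrix m n ℂ) hb
    (isClosed_le continuous_reInner_self continuous_const) fun a ha => ?_
  refine fun i _ j _ => ?_
  rw [mem_closedBall_zero_iff]
  have := (norm_sq_le_reInner a i j).trans ha
  rwa [sq_le_one_iff₀ (norm_nonneg _)] at this

/-- The fidelity with a continuous family of states indexed by the states attains its maximum. -/
lemma exists_state_rootFid_max [DecidableEq m] [DecidableEq n] {τ : Matrix n n ℂ}
    (hτ : τ.PosSemidef) {G : Matrix m m ℂ → Matrix n n ℂ} (hG : Continuous G)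
    (hGs : ∀ σ, IsState σ → IsState (G σ)) (hne : ∃ σ : Matrix m m ℂ, IsState σ) :
    ∃ σ, IsState σ ∧ ∀ σ', IsState σ' → rootFid τ (G σ') ≤ rootFid τ (G σ) := by
  -- Continuity of the fidelity is avoided. A state is encoded by a factor p.1 with σ = p.1ᴴ p.1,
  -- paired with a variational witness p.2 for G σ. These pairs form a compact set, on which the
  -- objective is a continuous inner product.
  let K : Set (Matrix m m ℂ × Matrix n n ℂ) :=
    {p | (p.1ᴴ * p.1).trace = 1 ∧ (G (p.1ᴴ * p.1) - p.2ᴴ * p.2).PosSemidef}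
  have hK1 : ∀ p ∈ K, IsState (p.1ᴴ * p.1) := fun p hp => ⟨posSemidef_conjTranspose_mul_self _, hp.1⟩
  have hKc : IsCompact K := by
    refine IsCompact.of_isClosed_subset
      ((isCompact_reInner_self_le (m := m) (n := m)).prod (isCompact_reInner_self_le (m := n) (n := n)))
      ?_ ?_
    · refine (isClosed_eq (by fun_prop) continuous_const).inter ?_
      exact isClosed_posSemidef.preimage (by fun_prop)
    · intro p hp
      refine ⟨?_, ?_⟩
      · rw [Set.mem_ofPred_eq, reInner_self, hp.1]
        simp
      · rw [Set.mem_ofPred_eq, reInner_self]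
        refine (trace_re_le_trace_re (Matrix.le_iff.2 hp.2)).trans ?_
        rw [(hGs _ (hK1 p hp)).2]
        simp
  have hKmem : ∀ σ', IsState σ' → ∃ p ∈ K, p.1ᴴ * p.1 = σ' ∧
      rootFid τ (G σ') = reInner (CFC.sqrt τ) p.2 := by
    intro σ' hσ'
    obtain ⟨U, -, h1, h2⟩ := exists_rootFid_eq_reInner (A := τ) (hGs σ' hσ').1
    have h3 := sqrt_conjTranspose_mul_sqrt hσ'.1
    refine ⟨(CFC.sqrt σ', _), ⟨?_, ?_⟩, h3, h2⟩
    · rw [h3, hσ'.2]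
    · rw [h3]
      exact h1
  have hKne : K.Nonempty := by
    obtain ⟨σ, hσ⟩ := hne
    obtain ⟨p, hp, -⟩ := hKmem σ hσ
    exact ⟨p, hp⟩
  obtain ⟨p, hp, hmax⟩ := hKc.exists_isMaxOn hKne
    (f := fun p => reInner (CFC.sqrt τ) p.2) (by unfold reInner; fun_prop)
  refine ⟨_, hK1 p hp, fun σ' hσ' => ?_⟩
  obtain ⟨q, hq, -, h⟩ := hKmem σ' hσ'
  rw [h]
  exact (hmax hq).trans (reInner_le_rootFid hτ (hGs _ (hK1 p hp)).1
    (sqrt_conjTranspose_mul_sqrt hτ).le hp.2)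

end Compactness

/-! ### Protocol states as block-diagonal operators -/

section BlockForms

variable {X B : Type*} [Fintype X] [DecidableEq X] [Fintype B] [DecidableEq B]

/-- The unnormalized conditional states `p_x φ^x`. -/
def CQState.part (ρ : CQState X B) (x : X) : Matrix B B ℂ := ρ.prob x • ρ.cond x

lemma CQState.part_posSemidef (ρ : CQState X B) (x : X) : (ρ.part x).PosSemidef :=
  smul_posSemidef (ρ.cond_isState x).1 (ρ.prob_nonneg x)

lemma CQState.sum_trace_part (ρ : CQState X B) : ∑ x, (ρ.part x).trace = 1 := by
  have : ∀ x, (ρ.part x).trace = (ρ.prob x : ℂ) := fun x => by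
    rw [CQState.part, Matrix.trace_smul, (ρ.cond_isState x).2]
    simp
  simp only [this]
  exact_mod_cast ρ.prob_sum

lemma CQState.op_eq_blocks (ρ : CQState X B) : ρ.op = blocks (Equiv.prodComm B X) ρ.part := by
  ext ⟨x, b⟩ ⟨y, c⟩
  simp only [CQState.op, Matrix.sum_apply, Matrix.smul_apply, Matrix.kroneckerMap_apply,
    Matrix.single_apply, blocks_apply, CQState.part, Equiv.prodComm_symm, Equiv.prodComm_apply,
    Prod.swap_prod_mk]
  rw [Finset.sum_eq_single x]
  · split_ifs <;> simp_all
  · intro z _ hz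
    simp [hz]
  · simp

lemma one_kronecker_eq_blocks (σ : Matrix B B ℂ) :
    (1 : Matrix X X ℂ) ⊗ₖ σ = blocks (Equiv.prodComm B X) fun _ => σ := by
  ext ⟨x, b⟩ ⟨y, c⟩
  by_cases h : x = y <;> simp [blocks_apply, h]

/-- The regrouping of the index set that collects the classical registers. -/
def groupClassical (Z B S : Type*) : B × (Z × S) ≃ (Z × B) × S where
  toFun p := ((p.2.1, p.1), p.2.2)
  invFun q := (q.1.2, (q.1.1, q.2))
  left_inv _ := rfl
  right_inv _ := rfl

/-- The final operator of a protocol for a general family of operators `A x` in place of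
`p_x φ^x`. -/
def Protocol.hashed (P : Protocol X) (A : X → Matrix B B ℂ) :
    Matrix ((P.Out × B) × P.Seed) ((P.Out × B) × P.Seed) ℂ :=
  blocks (groupClassical P.Out B P.Seed) fun q =>
    P.prob q.2 • ∑ x with P.hash q.2 x = q.1, A x

/-- The ideal operator with side information `σ`. -/
def Protocol.ideal (P : Protocol X) (σ : Matrix B B ℂ) :
    Matrix ((P.Out × B) × P.Seed) ((P.Out × B) × P.Seed) ℂ :=
  blocks (groupClassical P.Out B P.Seed) fun q =>
    P.prob q.2 • (Fintype.card P.Out : ℝ)⁻¹ • σ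

lemma Protocol.final_eq_hashed (P : Protocol X) (ρ : CQState X B) :
    P.final ρ = P.hashed ρ.part := by
  ext ⟨⟨z, b⟩, s⟩ ⟨⟨w, c⟩, t⟩
  simp only [Protocol.final, Protocol.outputGiven, Protocol.hashed, groupClassical,
    Matrix.sum_apply, Matrix.smul_apply, Matrix.kroneckerMap_apply, Matrix.single_apply,
    blocks_apply, CQState.part, Equiv.coe_fn_symm_mk, Prod.mk.injEq]
  rw [Finset.sum_eq_single s, Finset.sum_eq_single z]
  · split_ifs <;> simp_all
  · intro z' _ hz
    simp [hz]
  · simp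
  · intro s' _ hs
    simp [hs]
  · simp

lemma Protocol.ideal_eq (P : Protocol X) (σ : Matrix B B ℂ) :
    (P.uniform ⊗ₖ σ) ⊗ₖ P.seedState = P.ideal σ := by
  ext ⟨⟨z, b⟩, s⟩ ⟨⟨w, c⟩, t⟩
  simp only [Protocol.uniform, Protocol.seedState, Protocol.ideal, groupClassical,
    Matrix.sum_apply, Matrix.smul_apply, Matrix.kroneckerMap_apply, Matrix.single_apply,
    Matrix.one_apply, blocks_apply, Equiv.coe_fn_symm_mk, Prod.mk.injEq]
  rw [Finset.sum_eq_single s]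
  · split_ifs <;> simp_all
    ring
  · intro s' _ hs
    simp [hs]
  · simp

lemma CQState.nonempty (ρ : CQState X B) : Nonempty X := by
  by_contra h
  rw [not_nonempty_iff] at h
  simpa using ρ.prob_sum

lemma Protocol.card_out_pos (P : Protocol X) [hX : Nonempty X] : 0 < Fintype.card P.Out := by
  rw [Fintype.card_pos_iff]
  by_contra h
  rw [not_nonempty_iff] at h
  have : IsEmpty P.Seed := ⟨fun s => h.false (P.hash s hX.some)⟩
  simpa using P.prob_sum

lemma Protocol.hashed_posSemidef (P : Protocol X) {A : X → Matrix B B ℂ}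
    (hA : ∀ x, (A x).PosSemidef) : (P.hashed A).PosSemidef :=
  blocks_posSemidef _ fun _ => smul_posSemidef (Matrix.posSemidef_sum _ fun x _ => hA x)
    (P.prob_nonneg _)

lemma Protocol.ideal_posSemidef (P : Protocol X) {σ : Matrix B B ℂ} (hσ : σ.PosSemidef) :
    (P.ideal σ).PosSemidef :=
  blocks_posSemidef _ fun _ => smul_posSemidef (smul_posSemidef hσ (by positivity))
    (P.prob_nonneg _)

lemma Protocol.trace_hashed (P : Protocol X) (A : X → Matrix B B ℂ) :
    (P.hashed A).trace = ∑ x, (A x).trace := by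
  rw [Protocol.hashed, trace_blocks, Fintype.sum_prod_type_right]
  simp only [Matrix.trace_smul, Matrix.trace_sum]
  have : ∀ s, ∑ z, P.prob s • ∑ x with P.hash s x = z, (A x).trace =
      P.prob s • ∑ x, (A x).trace := fun s => by
    rw [← Finset.smul_sum, Finset.sum_fiberwise]
  simp only [this]
  rw [← Finset.sum_smul, P.prob_sum, one_smul]

lemma Protocol.trace_ideal (P : Protocol X) [Nonempty X] (σ : Matrix B B ℂ) :
    (P.ideal σ).trace = σ.trace := by
  rw [Protocol.ideal, trace_blocks, Fintype.sum_prod_type_right]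
  have h : (Fintype.card P.Out : ℝ) ≠ 0 := by exact_mod_cast P.card_out_pos.ne'
  simp only [Matrix.trace_smul, Finset.sum_const, Finset.card_univ]
  have : ∀ s, Fintype.card P.Out • P.prob s • (Fintype.card P.Out : ℝ)⁻¹ • σ.trace =
      P.prob s • σ.trace := fun s => by
    rw [smul_comm, ← Nat.cast_smul_eq_nsmul ℝ, smul_smul (Fintype.card P.Out : ℝ),
      mul_inv_cancel₀ h, one_smul]
  simp only [this]
  rw [← Finset.sum_smul, P.prob_sum, one_smul]

lemma Protocol.rootFid_hashed_ideal (P : Protocol X) {A : X → Matrix B B ℂ}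
    (hA : ∀ x, (A x).PosSemidef) {σ : Matrix B B ℂ} (hσ : σ.PosSemidef) :
    rootFid (P.hashed A) (P.ideal σ) = ∑ s, P.prob s *
      ∑ z, rootFid (∑ x with P.hash s x = z, A x) ((Fintype.card P.Out : ℝ)⁻¹ • σ) := by
  have h1 : ∀ s z, (∑ x with P.hash s x = z, A x).PosSemidef := fun s z =>
    Matrix.posSemidef_sum _ fun x _ => hA x
  have h2 : ((Fintype.card P.Out : ℝ)⁻¹ • σ).PosSemidef := smul_posSemidef hσ (by positivity)
  rw [Protocol.hashed, Protocol.ideal, rootFid_blocks _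
    (fun _ => smul_posSemidef (h1 _ _) (P.prob_nonneg _))
    (fun _ => smul_posSemidef h2 (P.prob_nonneg _)), Fintype.sum_prod_type_right]
  refine Finset.sum_congr rfl fun s _ => ?_
  rw [Finset.mul_sum]
  exact Finset.sum_congr rfl fun z _ => rootFid_smul_smul (h1 _ _) h2 (P.prob_nonneg _)

/-- Hashing does not decrease the fidelity. -/
lemma Protocol.sum_rootFid_le_rootFid_hashed (P : Protocol X) {A A' : X → Matrix B B ℂ}
    (hA : ∀ x, (A x).PosSemidef) (hA' : ∀ x, (A' x).PosSemidef) :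
    ∑ x, rootFid (A x) (A' x) ≤ rootFid (P.hashed A) (P.hashed A') := by
  have h1 : ∀ s z, (∑ x with P.hash s x = z, A x).PosSemidef := fun s z =>
    Matrix.posSemidef_sum _ fun x _ => hA x
  have h2 : ∀ s z, (∑ x with P.hash s x = z, A' x).PosSemidef := fun s z =>
    Matrix.posSemidef_sum _ fun x _ => hA' x
  rw [Protocol.hashed, Protocol.hashed, rootFid_blocks _
    (fun _ => smul_posSemidef (h1 _ _) (P.prob_nonneg _))
    (fun _ => smul_posSemidef (h2 _ _) (P.prob_nonneg _)), Fintype.sum_prod_type_right]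
  have key : ∀ s, P.prob s * ∑ x, rootFid (A x) (A' x) ≤
      ∑ z, rootFid (P.prob s • ∑ x with P.hash s x = z, A x)
        (P.prob s • ∑ x with P.hash s x = z, A' x) := fun s => by
    rw [← Finset.sum_fiberwise _ (P.hash s), Finset.mul_sum]
    refine Finset.sum_le_sum fun z _ => ?_
    rw [rootFid_smul_smul (h1 _ _) (h2 _ _) (P.prob_nonneg _)]
    exact mul_le_mul_of_nonneg_left (sum_rootFid_le _ hA hA') (P.prob_nonneg s)
  refine le_trans (le_of_eq ?_) (Finset.sum_le_sum fun s _ => key s)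
  rw [← Finset.sum_mul, P.prob_sum, one_mul]

end BlockForms

/-! ### Upper bound on the extractable length, and existence of the maximum -/

section Converse

variable {X B : Type*} [Fintype X] [DecidableEq X] [Fintype B] [DecidableEq B]

lemma Protocol.isState_final (P : Protocol X) (ρ : CQState X B) : IsState (P.hashed ρ.part) :=
  ⟨P.hashed_posSemidef ρ.part_posSemidef, by rw [P.trace_hashed, ρ.sum_trace_part]⟩

lemma CQState.isState_op (ρ : CQState X B) : IsState ρ.op := by
  rw [ρ.op_eq_blocks]
  exact ⟨blocks_posSemidef _ ρ.part_posSemidef, by rw [trace_blocks, ρ.sum_trace_part]⟩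

lemma Protocol.isState_ideal (P : Protocol X) [Nonempty X] {σ : Matrix B B ℂ} (hσ : IsState σ) :
    IsState (P.ideal σ) :=
  ⟨P.ideal_posSemidef hσ.1, by rw [P.trace_ideal, hσ.2]⟩

lemma Protocol.secrecyDistance_eq (P : Protocol X) (ρ : CQState X B) :
    P.secrecyDistance ρ = ⨅ σ : {σ : Matrix B B ℂ // IsState σ},
      purifiedDistance (P.hashed ρ.part) (P.ideal σ.1) := by
  simp only [Protocol.secrecyDistance, P.final_eq_hashed, P.ideal_eq]

lemma Protocol.secrecyDistance_le (P : Protocol X) (ρ : CQState X B) {σ : Matrix B B ℂ}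
    (hσ : IsState σ) : P.secrecyDistance ρ ≤ purifiedDistance (P.hashed ρ.part) (P.ideal σ) := by
  rw [P.secrecyDistance_eq]
  exact ciInf_le ⟨0, by rintro _ ⟨τ, rfl⟩; exact purifiedDistance_nonneg _ _⟩
    (⟨σ, hσ⟩ : {σ : Matrix B B ℂ // IsState σ})

/-- The infimum in the secrecy distance is attained. -/
lemma Protocol.exists_secrecyDistance_eq (P : Protocol X) (ρ : CQState X B) :
    ∃ σ, IsState σ ∧ P.secrecyDistance ρ = purifiedDistance (P.hashed ρ.part) (P.ideal σ) := by
  have hX := ρ.nonempty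
  have hne : ∃ σ : Matrix B B ℂ, IsState σ := ⟨_, ρ.cond_isState hX.some⟩
  have hG : Continuous (P.ideal : Matrix B B ℂ → _) := by
    refine continuous_matrix fun x y => ?_
    simp only [Protocol.ideal, blocks_apply, Matrix.smul_apply]
    split_ifs
    · fun_prop
    · exact continuous_const
  obtain ⟨σ, hσ, hmax⟩ := exists_state_rootFid_max (P.isState_final ρ).1 hG
    (fun σ hσ => P.isState_ideal hσ) hne
  refine ⟨σ, hσ, le_antisymm (P.secrecyDistance_le ρ hσ) ?_⟩
  rw [P.secrecyDistance_eq]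
  have : Nonempty {σ : Matrix B B ℂ // IsState σ} := ⟨⟨σ, hσ⟩⟩
  refine le_ciInf fun τ => ?_
  have ht := (P.isState_final ρ).2
  rw [purifiedDistance, purifiedDistance, fidelity_of_trace_eq_one ht,
    fidelity_of_trace_eq_one ht]
  refine Real.sqrt_le_sqrt (sub_le_sub_left ?_ _)
  exact pow_le_pow_left₀ (rootFid_nonneg _ _) (hmax _ τ.2) 2

/-- An extractable length bounds the min-entropy of a nearby sub-normalized state. -/
lemma exists_subState_of_mem_extractableLengths {ρ : CQState X B} {ε : ℝ} (hε0 : 0 ≤ ε)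
    (hε : ε < 1) {l : ℕ} (hl : l ∈ extractableLengths ε ρ) :
    ∃ (σ : Matrix B B ℂ) (ρ' : Matrix (X × B) (X × B) ℂ), IsState σ ∧ IsSubState ρ' ∧
      purifiedDistance ρ' ρ.op ≤ ε ∧ 1 - ε ^ 2 ≤ ρ'.trace.re ∧
      ρ' ≤ (2 : ℝ) ^ (-(l : ℝ)) • ((1 : Matrix X X ℂ) ⊗ₖ σ) := by
  obtain ⟨P, hlP, hPε⟩ := hl
  have hX := ρ.nonempty
  obtain ⟨σ, hσ, hd⟩ := P.exists_secrecyDistance_eq ρ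
  rw [hd, purifiedDistance_le_iff hε0, fidelity_of_trace_eq_one (P.isState_final ρ).2] at hPε
  have hε2 : 0 < 1 - ε ^ 2 := by nlinarith
  have hk : (0 : ℝ) < Fintype.card P.Out := by exact_mod_cast P.card_out_pos
  set ω := (Fintype.card P.Out : ℝ)⁻¹ • σ with hω
  have hωp : ω.PosSemidef := smul_posSemidef hσ.1 (by positivity)
  set f : P.Seed → ℝ := fun s => ∑ z, rootFid (∑ x with P.hash s x = z, ρ.part x) ω with hf
  have hsum : rootFid (P.hashed ρ.part) (P.ideal σ) = ∑ s, P.prob s * f s :=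
    P.rootFid_hashed_ideal ρ.part_posSemidef hσ.1
  -- The fidelity is an average over seeds, so some single seed does at least as well.
  obtain ⟨s, hs⟩ : ∃ s, rootFid (P.hashed ρ.part) (P.ideal σ) ≤ f s := by
    by_contra! hcon
    have hlt : ∑ s, P.prob s * f s < ∑ s, P.prob s * rootFid (P.hashed ρ.part) (P.ideal σ) := by
      obtain ⟨s, -, hs⟩ : ∃ s ∈ Finset.univ, P.prob s ≠ 0 := by
        apply Finset.exists_ne_zero_of_sum_ne_zero
        rw [P.prob_sum]
        exact one_ne_zero
      refine Finset.sum_lt_sum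
        (fun s _ => mul_le_mul_of_nonneg_left (hcon s).le (P.prob_nonneg s)) ⟨s, Finset.mem_univ _, ?_⟩
      exact mul_lt_mul_of_pos_left (hcon s) (lt_of_le_of_ne (P.prob_nonneg s) hs.symm)
    rw [← Finset.sum_mul, P.prob_sum, one_mul, ← hsum] at hlt
    exact lt_irrefl _ hlt
  choose W hW1 hW2 hW3 using fun z => exists_extension
    (Finset.univ.filter fun x => P.hash s x = z) ρ.part_posSemidef hωp
  set A : X → Matrix B B ℂ := fun x => W (P.hash s x) x with hA
  have hAp : ∀ x, (A x).PosSemidef := fun x => hW1 _ x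
  have hfib : ∀ z, ∑ x with P.hash s x = z, A x = ∑ x with P.hash s x = z, W z x := fun z =>
    Finset.sum_congr rfl fun x hx => by rw [hA, ← (Finset.mem_filter.1 hx).2]
  have hAω : ∀ x, A x ≤ ω := fun x => by
    refine le_trans ?_ (hW2 (P.hash s x))
    exact Finset.single_le_sum (f := W (P.hash s x))
      (fun y _ => Matrix.nonneg_iff_posSemidef.2 (hW1 _ y)) (by simp)
  have hfA : f s ≤ ∑ x, rootFid (ρ.part x) (A x) := by
    rw [← Finset.sum_fiberwise _ (P.hash s)]
    refine Finset.sum_le_sum fun z _ => (hW3 z).trans (le_of_eq ?_)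
    exact Finset.sum_congr rfl fun x hx => by rw [hA, ← (Finset.mem_filter.1 hx).2]
  set ρ' := blocks (Equiv.prodComm B X) A with hρ'
  have hρ'p : ρ'.PosSemidef := blocks_posSemidef _ hAp
  have hF : f s ≤ rootFid ρ' ρ.op := by
    rw [rootFid_comm hρ'p ρ.isState_op.1, ρ.op_eq_blocks, rootFid_blocks _ ρ.part_posSemidef hAp]
    exact hfA
  have hF2 : 1 - ε ^ 2 ≤ rootFid ρ' ρ.op ^ 2 :=
    hPε.trans (pow_le_pow_left₀ (rootFid_nonneg _ _) (hs.trans hF) 2)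
  have htr : 1 - ε ^ 2 ≤ ρ'.trace.re := by
    have := rootFid_sq_le hρ'p ρ.isState_op.1
    rw [ρ.isState_op.2] at this
    simp only [Complex.one_re, mul_one] at this
    linarith
  -- The fibre sums are at most ω for each output, and the |Z| copies of ω add up to σ.
  have htr1 : ρ'.trace.re ≤ 1 := by
    have h1 : ∑ x, A x ≤ ∑ _z : P.Out, ω := by
      rw [← Finset.sum_fiberwise _ (P.hash s)]
      exact Finset.sum_le_sum fun z _ => (hfib z).le.trans (hW2 z)
    have h2 := trace_re_le_trace_re h1
    rw [hρ', trace_blocks, ← Matrix.trace_sum]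
    refine h2.trans (le_of_eq ?_)
    rw [Finset.sum_const, Finset.card_univ, ← Nat.cast_smul_eq_nsmul ℝ, hω, smul_smul,
      mul_inv_cancel₀ hk.ne', one_smul, hσ.2]
    simp
  refine ⟨σ, ρ', hσ, ⟨hρ'p, hε2.trans_le htr, htr1⟩, ?_, htr, ?_⟩
  · rw [purifiedDistance_comm hρ'p ρ.isState_op.1, purifiedDistance_le_iff hε0,
      fidelity_of_trace_eq_one ρ.isState_op.2, rootFid_comm ρ.isState_op.1 hρ'p]
    exact hF2
  · have h2 : (Fintype.card P.Out : ℝ)⁻¹ ≤ (2 : ℝ) ^ (-(l : ℝ)) := by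
      rw [Real.rpow_neg (by norm_num)]
      apply inv_anti₀ (by positivity)
      exact (Real.le_logb_iff_rpow_le (by norm_num) hk).1 hlP
    have h3 : ρ' ≤ (Fintype.card P.Out : ℝ)⁻¹ • ((1 : Matrix X X ℂ) ⊗ₖ σ) := by
      have : (Fintype.card P.Out : ℝ)⁻¹ • ((1 : Matrix X X ℂ) ⊗ₖ σ) = (1 : Matrix X X ℂ) ⊗ₖ ω := by
        rw [hω, Matrix.kronecker_smul]
      rw [this, one_kronecker_eq_blocks]
      exact blocks_mono _ hAω
    refine h3.trans ?_
    have h4 : ((1 : Matrix X X ℂ) ⊗ₖ σ).PosSemidef := Matrix.PosSemidef.one.kronecker hσ.1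
    rw [Matrix.le_iff, ← sub_smul]
    exact smul_posSemidef h4 (sub_nonneg.2 h2)

lemma natCast_le_smoothHMin {ρ : CQState X B} {ε : ℝ} (hε0 : 0 ≤ ε) (hε : ε < 1) {l : ℕ}
    (hl : l ∈ extractableLengths ε ρ) : ((l : ℝ) : EReal) ≤ smoothHMin ε ρ.op := by
  obtain ⟨σ, ρ', hσ, hρ', hP, -, hle⟩ := exists_subState_of_mem_extractableLengths hε0 hε hl
  refine le_trans ?_ (le_iSup₂ (f := fun (σ : Matrix B B ℂ) (_ : IsState σ) =>
    -smoothDMax ε ρ.op ((1 : Matrix X X ℂ) ⊗ₖ σ)) σ hσ)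
  rw [EReal.le_neg]
  refine (iInf₂_le ρ' ⟨hρ', hP⟩).trans ((iInf₂_le (-(l : ℝ)) hle).trans ?_)
  simp

/-- Taking traces in ρ' ≤ 2^(-l) 1 ⊗ σ gives 1 - ε² ≤ 2^(-l) |X|; the crude estimate l ≤ 2^l then
suffices. -/
lemma bddAbove_extractableLengths (ρ : CQState X B) {ε : ℝ} (hε0 : 0 ≤ ε) (hε : ε < 1) :
    BddAbove (extractableLengths ε ρ) := by
  have hε2 : 0 < 1 - ε ^ 2 := by nlinarith
  refine ⟨⌈(Fintype.card X : ℝ) / (1 - ε ^ 2)⌉₊, fun l hl => ?_⟩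
  obtain ⟨σ, ρ', hσ, -, -, htr, hle⟩ := exists_subState_of_mem_extractableLengths hε0 hε hl
  have h1 := htr.trans (trace_re_le_trace_re hle)
  rw [Matrix.trace_smul, Matrix.trace_kronecker, hσ.2, Matrix.trace_one,
    Real.rpow_neg (by norm_num), Real.rpow_natCast] at h1
  simp only [mul_one, Complex.real_smul, Complex.re_ofReal_mul, Complex.natCast_re] at h1
  have h2 : (l : ℝ) ≤ Fintype.card X / (1 - ε ^ 2) := by
    rw [le_div_iff₀ hε2]
    have h3 : (l : ℝ) ≤ 2 ^ l := by exact_mod_cast Nat.lt_two_pow_self.le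
    calc (l : ℝ) * (1 - ε ^ 2) ≤ 2 ^ l * ((2 ^ l)⁻¹ * Fintype.card X) := by
          apply mul_le_mul h3 h1 hε2.le (by positivity)
      _ = Fintype.card X := by rw [mul_inv_cancel_left₀ (by positivity)]
  exact_mod_cast h2.trans (Nat.le_ceil _)

/-- The trivial protocol, with a single output. -/
def trivialProtocol (X : Type*) : Protocol X where
  Seed := Unit
  Out := Unit
  prob _ := 1
  prob_nonneg _ := zero_le_one
  prob_sum := by simp
  hash _ _ := ()

lemma card_out_trivialProtocol (X : Type*) : Fintype.card (trivialProtocol X).Out = 1 :=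
  Fintype.card_unit

lemma zero_mem_extractableLengths (ρ : CQState X B) {ε : ℝ} (hε0 : 0 ≤ ε) :
    0 ∈ extractableLengths ε ρ := by
  refine ⟨trivialProtocol X, by simp [card_out_trivialProtocol], ?_⟩
  -- With a single output, the final state is already ideal for the marginal on B.
  have hσ : IsState (∑ x, ρ.part x) :=
    ⟨Matrix.posSemidef_sum _ fun x _ => ρ.part_posSemidef x, by
      rw [Matrix.trace_sum, ρ.sum_trace_part]⟩
  refine ((trivialProtocol X).secrecyDistance_le ρ hσ).trans ?_
  have hst := (trivialProtocol X).isState_final ρ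
  have : (trivialProtocol X).ideal (∑ x, ρ.part x) = (trivialProtocol X).hashed ρ.part := by
    unfold Protocol.ideal Protocol.hashed
    congr 1
    funext q
    have hq : ∀ x, (trivialProtocol X).hash q.2 x = q.1 := fun _ => rfl
    rw [card_out_trivialProtocol, Finset.filter_true_of_mem fun x _ => hq x]
    simp
  rw [this, purifiedDistance_le_iff hε0, fidelity_of_trace_eq_one hst.2]
  have h1 := trace_re_le_rootFid_self hst.1
  rw [hst.2, Complex.one_re] at h1
  nlinarith [sq_nonneg ε]

end Converse

/-! ### Operator inequalities with an inverse weight -/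

section InverseWeight

variable {n : Type*} [Fintype n] [DecidableEq n]

/-- With G = S⁻¹A, add (1 - G)ᴴ A (1 - G) ≥ 0 to Gᴴ (S - A) G ≥ 0. This avoids antitonicity of the
inverse and needs no invertibility of A. -/
lemma mul_inv_mul_self_le {A S : Matrix n n ℂ} (hA : A.PosSemidef) (hS : S.PosDef) (h : A ≤ S) :
    A * S⁻¹ * A ≤ A := by
  have hAh : Aᴴ = A := hA.1
  have hSi : (S⁻¹)ᴴ = S⁻¹ := hS.inv.1
  have hinv : S⁻¹ * S = 1 := Matrix.nonsing_inv_mul S ((Matrix.isUnit_iff_isUnit_det S).1 hS.isUnit)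
  have h1 := conj_mono h (S⁻¹ * A)
  have e1 : (S⁻¹ * A)ᴴ * S * (S⁻¹ * A) = A * S⁻¹ * A := by
    rw [conjTranspose_mul, hAh, hSi, Matrix.mul_assoc A, hinv, Matrix.mul_one, Matrix.mul_assoc]
  have h2 := hA.conjTranspose_mul_mul_same (1 - S⁻¹ * A)
  have e2 : (1 - S⁻¹ * A)ᴴ * A * (1 - S⁻¹ * A) =
      A - 2 • (A * S⁻¹ * A) + (S⁻¹ * A)ᴴ * A * (S⁻¹ * A) := by
    rw [conjTranspose_sub, conjTranspose_one, conjTranspose_mul, hAh, hSi]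
    noncomm_ring
  rw [e2] at h2
  rw [e1] at h1
  have h3 := add_nonneg (Matrix.nonneg_iff_posSemidef.2 h2) (sub_nonneg.2 h1)
  rw [← sub_nonneg]
  convert h3 using 1
  abel

/-- An operator form of the arithmetic–geometric mean inequality: expand (cS - D) S⁻¹ (cS - D) ≥ 0.
Applied to D and -D, it replaces a bound on |D|. -/
lemma le_add_mul_inv_mul {S D : Matrix n n ℂ} (hS : S.PosDef) (hD : D.IsHermitian) {c : ℝ}
    (hc : 0 < c) : D ≤ (c / 2) • S + (1 / (2 * c)) • (D * S⁻¹ * D) := by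
  have hDh : Dᴴ = D := hD
  have hSh : Sᴴ = S := hS.1
  have hu := (Matrix.isUnit_iff_isUnit_det S).1 hS.isUnit
  have hinv : S⁻¹ * S = 1 := Matrix.nonsing_inv_mul S hu
  have hinv' : S * S⁻¹ = 1 := Matrix.mul_nonsing_inv S hu
  have h1 := hS.inv.posSemidef.conjTranspose_mul_mul_same (c • S - D)
  have e : (c • S - D)ᴴ * S⁻¹ * (c • S - D) = (c ^ 2) • S - (2 * c) • D + D * S⁻¹ * D := by
    rw [conjTranspose_sub, conjTranspose_smul, hDh, hSh, star_trivial]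
    simp only [Matrix.sub_mul, Matrix.mul_sub, Matrix.smul_mul, Matrix.mul_smul, hinv', hinv,
      Matrix.one_mul, Matrix.mul_assoc, Matrix.mul_one]
    module
  rw [e] at h1
  have h2 := smul_posSemidef h1 (c := 1 / (2 * c)) (by positivity)
  have e1 : 1 / (2 * c) * c ^ 2 = c / 2 := by field_simp
  have e2 : 1 / (2 * c) * (2 * c) = 1 := by field_simp
  rw [smul_add, smul_sub, smul_smul, smul_smul, e1, e2, one_smul] at h2
  rwa [sub_add_eq_add_sub, ← Matrix.le_iff] at h2

end InverseWeight

/-! ### Leftover hashing with a random function -/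

section LeftoverHash

variable {X B : Type*} [Fintype X] [DecidableEq X] [Fintype B] [DecidableEq B]

/-- The deviation of the indicator of `w = z` from its mean. -/
def Protocol.dev (P : Protocol X) (z w : P.Out) : ℝ :=
  (if w = z then 1 else 0) - (Fintype.card P.Out : ℝ)⁻¹

/-- The hash values of different inputs are uncorrelated. -/
def Protocol.Uncorrelated (P : Protocol X) : Prop :=
  ∀ x y, x ≠ y → ∀ z, ∑ s, P.prob s * (P.dev z (P.hash s x) * P.dev z (P.hash s y)) = 0

lemma Protocol.sum_dev_sq_le (P : Protocol X) (w : P.Out) : ∑ z, P.dev z w * P.dev z w ≤ 1 := by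
  have hk : (0 : ℝ) < Fintype.card P.Out := by exact_mod_cast Fintype.card_pos_iff.2 ⟨w⟩
  have : ∀ z, P.dev z w * P.dev z w = (if w = z then 1 - 2 * (Fintype.card P.Out : ℝ)⁻¹ else 0) +
      (Fintype.card P.Out : ℝ)⁻¹ ^ 2 := fun z => by
    unfold Protocol.dev
    split_ifs <;> ring
  simp only [this]
  rw [Finset.sum_add_distrib, Finset.sum_ite_eq, if_pos (Finset.mem_univ _), Finset.sum_const,
    Finset.card_univ, nsmul_eq_mul, sq, mul_inv_cancel_left₀ hk.ne']
  have := inv_pos.2 hk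
  linarith

lemma Protocol.hash_sub_mean (P : Protocol X) (A : X → Matrix B B ℂ) (s : P.Seed) (z : P.Out) :
    (∑ x with P.hash s x = z, A x) - (Fintype.card P.Out : ℝ)⁻¹ • ∑ x, A x =
      ∑ x, P.dev z (P.hash s x) • A x := by
  simp only [Protocol.dev, sub_smul, Finset.sum_sub_distrib, ite_smul, one_smul, zero_smul,
    Finset.smul_sum, Finset.sum_filter]

/-- The second moment bound for uncorrelated hash values. -/
lemma Protocol.second_moment_le (P : Protocol X) (hP : P.Uncorrelated) {A : X → Matrix B B ℂ}
    (hA : ∀ x, (A x).PosSemidef) {S : Matrix B B ℂ} (hS : S.PosDef) (hAS : ∀ x, A x ≤ S) :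
    ∑ s, P.prob s * ∑ z, ((∑ x, P.dev z (P.hash s x) • A x) * S⁻¹ *
      (∑ x, P.dev z (P.hash s x) • A x)).trace.re ≤ ∑ x, (A x).trace.re := by
  set Q : X → X → ℝ := fun x y => (A x * S⁻¹ * A y).trace.re with hQ
  have hexp : ∀ s z, ((∑ x, P.dev z (P.hash s x) • A x) * S⁻¹ *
      (∑ x, P.dev z (P.hash s x) • A x)).trace.re =
      ∑ x, ∑ y, P.dev z (P.hash s x) * P.dev z (P.hash s y) * Q x y := fun s z => by
    simp only [Finset.sum_mul, Finset.mul_sum, Matrix.trace_sum, Complex.re_sum, Matrix.smul_mul,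
      Matrix.mul_smul, Matrix.trace_smul, hQ]
    rw [Finset.sum_comm]
    refine Finset.sum_congr rfl fun x _ => Finset.sum_congr rfl fun y _ => ?_
    simp
    ring
  have hQd : ∀ x, 0 ≤ Q x x := fun x => by
    have := hS.inv.posSemidef.conjTranspose_mul_mul_same (A x)
    rw [(hA x).1] at this
    exact trace_re_nonneg this
  have hsw : ∑ s, P.prob s * ∑ z, ∑ x, ∑ y, P.dev z (P.hash s x) * P.dev z (P.hash s y) * Q x y =
      ∑ x, ∑ y, ∑ z, (∑ s, P.prob s * (P.dev z (P.hash s x) * P.dev z (P.hash s y))) * Q x y := by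
    simp only [Finset.mul_sum, Finset.sum_mul]
    rw [Finset.sum_comm]
    simp_rw [Finset.sum_comm (s := (Finset.univ : Finset P.Seed))]
    rw [Finset.sum_comm]
    refine Finset.sum_congr rfl fun x _ => ?_
    rw [Finset.sum_comm]
    refine Finset.sum_congr rfl fun y _ => Finset.sum_congr rfl fun z _ =>
      Finset.sum_congr rfl fun s _ => by ring
  simp only [hexp]
  rw [hsw]
  refine Finset.sum_le_sum fun x _ => ?_
  -- Only y = x survives, because hash values of distinct inputs are uncorrelated. The diagonal
  -- terms are controlled by A_x S⁻¹ A_x ≤ A_x.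
  rw [Finset.sum_eq_single x]
  · rw [← Finset.sum_mul, Finset.sum_comm]
    simp only [← Finset.mul_sum]
    have h1 : ∑ s, P.prob s * ∑ z, P.dev z (P.hash s x) * P.dev z (P.hash s x) ≤ 1 := by
      rw [← P.prob_sum]
      exact Finset.sum_le_sum fun s _ =>
        mul_le_of_le_one_right (P.prob_nonneg s) (P.sum_dev_sq_le _)
    exact (mul_le_of_le_one_left (hQd x) h1).trans
      (trace_re_le_trace_re (mul_inv_mul_self_le (hA x) hS (hAS x)))
  · intro y _ hy
    exact Finset.sum_eq_zero fun z _ => by rw [hP x y hy.symm z, zero_mul]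
  · simp

/-- A leftover hashing lemma for the fidelity. -/
lemma Protocol.le_fidelity_hashed_ideal (P : Protocol X) [Nonempty X] (hP : P.Uncorrelated)
    {A : X → Matrix B B ℂ}
    (hA : ∀ x, (A x).PosSemidef) (hA1 : ∑ x, (A x).trace.re ≤ 1) {S : Matrix B B ℂ}
    (hS : S.PosDef) (hAS : ∀ x, A x ≤ S) {c : ℝ} (hc : 0 < c) :
    1 - (c / 2 * (Fintype.card P.Out * S.trace.re) + 1 / (2 * c)) / 2 ≤
      fidelity (P.hashed A) (P.ideal (∑ x, A x)) := by
  set k : ℝ := (Fintype.card P.Out : ℝ) with hk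
  have hk0 : 0 < k := by
    rw [hk]
    exact_mod_cast P.card_out_pos
  set T : ℝ := ∑ x, (A x).trace.re with hT
  have hTtr : (∑ x, A x).trace.re = T := by rw [Matrix.trace_sum, Complex.re_sum]
  have hsum : (∑ x, A x).PosSemidef := Matrix.posSemidef_sum _ fun x _ => hA x
  set D : P.Seed → P.Out → Matrix B B ℂ := fun s z => ∑ x, P.dev z (P.hash s x) • A x with hD
  set N : P.Seed → P.Out → Matrix B B ℂ := fun s z =>
    (c / 2) • S + (1 / (2 * c)) • (D s z * S⁻¹ * D s z) with hN
  have hDh : ∀ s z, (D s z).IsHermitian := fun s z => by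
    rw [Matrix.IsHermitian, hD, Matrix.conjTranspose_sum]
    refine Finset.sum_congr rfl fun x _ => ?_
    rw [conjTranspose_smul, star_trivial, (hA x).1]
  have hN1 : ∀ s z, D s z ≤ N s z := fun s z => le_add_mul_inv_mul hS (hDh s z) hc
  have hN2 : ∀ s z, -D s z ≤ N s z := fun s z => by
    have := le_add_mul_inv_mul hS (hDh s z).neg hc
    simpa [hN] using this
  have hps : ∀ s z, ((∑ x with P.hash s x = z, (A x).trace.re) + k⁻¹ * T - (N s z).trace.re) / 2 ≤
      rootFid (∑ x with P.hash s x = z, A x) (k⁻¹ • ∑ x, A x) := fun s z => by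
    have h := powers_stormer (Matrix.posSemidef_sum _ fun x _ => hA x)
      (smul_posSemidef hsum (inv_nonneg.2 hk0.le)) (N := N s z)
      (A := ∑ x with P.hash s x = z, A x) (by rw [P.hash_sub_mean]; exact hN1 s z)
      (by rw [← neg_sub, P.hash_sub_mean]; exact hN2 s z)
    rw [Matrix.trace_smul, Complex.smul_re, hTtr, Matrix.trace_sum, Complex.re_sum] at h
    exact h
  have hNt : ∀ s, ∑ z, (N s z).trace.re = c / 2 * (k * S.trace.re) +
      1 / (2 * c) * ∑ z, (D s z * S⁻¹ * D s z).trace.re := fun s => by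
    simp only [hN, Matrix.trace_add, Matrix.trace_smul, Complex.add_re, Complex.smul_re,
      Finset.sum_add_distrib, Finset.sum_const, Finset.card_univ, ← Finset.mul_sum, smul_eq_mul,
      nsmul_eq_mul, hk]
    ring
  have hsec := P.second_moment_le hP hA hS hAS
  change ∑ s, P.prob s * ∑ z, (D s z * S⁻¹ * D s z).trace.re ≤ T at hsec
  have hroot : T - (c / 2 * (k * S.trace.re) + 1 / (2 * c)) / 2 ≤
      rootFid (P.hashed A) (P.ideal (∑ x, A x)) := by
    rw [P.rootFid_hashed_ideal hA hsum]
    have h1 : ∀ s, P.prob s * (T - (c / 2 * (k * S.trace.re)) / 2 -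
        1 / (2 * c) / 2 * ∑ z, (D s z * S⁻¹ * D s z).trace.re) ≤
        P.prob s * ∑ z, rootFid (∑ x with P.hash s x = z, A x) (k⁻¹ • ∑ x, A x) := fun s => by
      refine mul_le_mul_of_nonneg_left ?_ (P.prob_nonneg s)
      refine le_trans (le_of_eq ?_) (Finset.sum_le_sum fun z _ => hps s z)
      rw [← Finset.sum_div, Finset.sum_sub_distrib, Finset.sum_add_distrib, Finset.sum_fiberwise,
        hNt, Finset.sum_const, Finset.card_univ, nsmul_eq_mul, ← hk, mul_inv_cancel_left₀ hk0.ne',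
        ← hT]
      ring
    refine le_trans ?_ (Finset.sum_le_sum fun s _ => h1 s)
    simp only [mul_sub (P.prob _), Finset.sum_sub_distrib, ← Finset.sum_mul, P.prob_sum, one_mul]
    have h2 : ∑ s, P.prob s * (1 / (2 * c) / 2 * ∑ z, (D s z * S⁻¹ * D s z).trace.re) =
        1 / (2 * c) / 2 * ∑ s, P.prob s * ∑ z, (D s z * S⁻¹ * D s z).trace.re := by
      rw [Finset.mul_sum]
      exact Finset.sum_congr rfl fun s _ => by ring
    rw [h2]
    have h3 : 1 / (2 * c) / 2 * ∑ s, P.prob s * ∑ z, (D s z * S⁻¹ * D s z).trace.re ≤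
        1 / (2 * c) / 2 * 1 := mul_le_mul_of_nonneg_left (hsec.trans hA1) (by positivity)
    linarith
  have ht1 : (P.hashed A).trace.re = T := by rw [P.trace_hashed, Complex.re_sum]
  have ht2 : (P.ideal (∑ x, A x)).trace.re = T := by rw [P.trace_ideal, hTtr]
  -- Both operators have trace T, so the correction term is exactly 1 - T and raises the leading T
  -- to 1.
  rw [fidelity_eq, ht1, ht2, Real.sqrt_mul_self (by linarith)]
  linarith

/-- Distinct coordinates of a uniform function are independent: summing over the i-th value alone
already gives zero. -/
lemma sum_pi_mul_eq_zero {ι Z : Type*} [Fintype ι] [DecidableEq ι] [Fintype Z] {u : Z → ℝ}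
    (hu : ∑ z, u z = 0) {i j : ι} (hij : i ≠ j) : ∑ s : ι → Z, u (s i) * u (s j) = 0 := by
  rw [← Equiv.sum_comp (Equiv.funSplitAt i Z).symm, Fintype.sum_prod_type_right]
  refine Finset.sum_eq_zero fun r _ => ?_
  have : ∀ w, u ((Equiv.funSplitAt i Z).symm (w, r) i) * u ((Equiv.funSplitAt i Z).symm (w, r) j) =
      u w * u (r ⟨j, hij.symm⟩) := fun w => by
    simp [Equiv.funSplitAt, Equiv.piSplitAt, hij.symm]
  simp only [this]
  rw [← Finset.sum_mul, hu, zero_mul]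

/-- Hashing with a uniformly random function to `2 ^ l` values. -/
def randomFunctionProtocol (X : Type*) [Fintype X] (l : ℕ) : Protocol X where
  -- Numbering the inputs keeps the seed set in `Type`, whatever the universe of `X`.
  Seed := Fin (Fintype.card X) → Fin (2 ^ l)
  Out := Fin (2 ^ l)
  prob _ := (Fintype.card (Fin (Fintype.card X) → Fin (2 ^ l)) : ℝ)⁻¹
  prob_nonneg _ := by positivity
  prob_sum := by
    rw [Finset.sum_const, Finset.card_univ, nsmul_eq_mul]
    exact mul_inv_cancel₀ (by exact_mod_cast Fintype.card_ne_zero)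
  hash s x := s (Fintype.equivFin X x)

lemma card_out_randomFunctionProtocol (X : Type*) [Fintype X] (l : ℕ) :
    Fintype.card (randomFunctionProtocol X l).Out = 2 ^ l :=
  Fintype.card_fin _

lemma randomFunctionProtocol_uncorrelated (X : Type*) [Fintype X] (l : ℕ) :
    (randomFunctionProtocol X l).Uncorrelated := by
  intro x y hxy z
  have hu : ∑ w, (randomFunctionProtocol X l).dev z w = 0 := by
    simp only [Protocol.dev]
    rw [Finset.sum_sub_distrib, Finset.sum_ite_eq', if_pos (Finset.mem_univ _), Finset.sum_const,
      Finset.card_univ, nsmul_eq_mul, mul_inv_cancel₀, sub_self]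
    rw [card_out_randomFunctionProtocol]
    positivity
  have hij : Fintype.equivFin X x ≠ Fintype.equivFin X y := fun h =>
    hxy ((Fintype.equivFin X).injective h)
  have := sum_pi_mul_eq_zero (Z := Fin (2 ^ l)) hu hij
  rw [← mul_zero ((Fintype.card (Fin (Fintype.card X) → Fin (2 ^ l)) : ℝ)⁻¹), ← this,
    Finset.mul_sum]
  rfl

end LeftoverHash

/-! ### Lower bound on the extractable length -/

section Achievability

variable {X B : Type*} [Fintype X] [DecidableEq X] [Fintype B] [DecidableEq B]

/-- Because F² ≥ 2F - 1. -/
lemma purifiedDistance_le_of_fidelity {n : Type*} [Fintype n] [DecidableEq n] {ρ σ : Matrix n n ℂ}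
    {η : ℝ} (hη : 0 ≤ η) (h : 1 - η ^ 2 / 2 ≤ fidelity ρ σ) : purifiedDistance ρ σ ≤ η := by
  rw [purifiedDistance_le_iff hη]
  nlinarith [sq_nonneg (1 - fidelity ρ σ)]

lemma mem_extractableLengths_of_le {ρ : CQState X B} {δ η t : ℝ} (hδ : 0 ≤ δ) (hη : 0 < η)
    {σ : Matrix B B ℂ} (hσ : IsState σ) {ρ' : Matrix (X × B) (X × B) ℂ}
    (hρ' : IsSubState ρ') (hP : purifiedDistance ρ' ρ.op ≤ δ)
    (hle : ρ' ≤ (2 : ℝ) ^ t • ((1 : Matrix X X ℂ) ⊗ₖ σ)) {l : ℕ}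
    (hl : (2 : ℝ) ^ l * 2 ^ t ≤ η ^ 4 / 4) : l ∈ extractableLengths (δ + η) ρ := by
  have hX := ρ.nonempty
  have hB : Nonempty B := by
    by_contra h
    rw [not_nonempty_iff] at h
    simpa [Matrix.trace] using hσ.2
  set P := randomFunctionProtocol X l with hPdef
  have hcard : (Fintype.card P.Out : ℝ) = 2 ^ l := by
    rw [hPdef, card_out_randomFunctionProtocol]
    norm_num
  refine ⟨P, ?_, ?_⟩
  · rw [hcard, Real.logb_pow, Real.logb_self_eq_one (by norm_num), mul_one]
  set e := Equiv.prodComm B X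
  -- ρ' need not be classical on X. Its diagonal blocks suffice, since pinching preserves the trace
  -- and the bound by 2^t σ.
  set A : X → Matrix B B ℂ := fun x => ρ'.submatrix (fun b => e (b, x)) (fun b => e (b, x)) with hA
  have hAp : ∀ x, (A x).PosSemidef := fun x => hρ'.1.submatrix _
  have hAtr : ∑ x, (A x).trace.re = ρ'.trace.re := by
    simp only [hA, Matrix.trace, Complex.re_sum, Fintype.sum_prod_type, Matrix.diag]
    rfl
  have hAσ : ∀ x, A x ≤ (2 : ℝ) ^ t • σ := fun x => by
    rw [one_kronecker_eq_blocks, Matrix.le_iff] at hle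
    have := hle.submatrix (fun b => e (b, x))
    rw [Matrix.le_iff]
    convert this using 1
    ext b c
    simp [hA, blocks_apply, e]
  set w : ℝ := 2 ^ t with hw
  have hw0 : 0 < w := by positivity
  set d : ℝ := (Fintype.card B : ℝ) with hd
  have hd0 : 0 < d := by
    rw [hd]
    exact_mod_cast Fintype.card_pos
  -- σ may be singular. The added multiple of the identity makes S invertible and only doubles the
  -- trace, to 2w.
  set S : Matrix B B ℂ := w • σ + (w / d) • 1 with hS
  have hone : ((w / d) • (1 : Matrix B B ℂ)).PosDef := Matrix.PosDef.one.smul (by positivity)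
  have hSp : S.PosDef := Matrix.PosDef.posSemidef_add (smul_posSemidef hσ.1 hw0.le) hone
  have hAS : ∀ x, A x ≤ S := fun x => (hAσ x).trans
    (le_add_of_nonneg_right (Matrix.nonneg_iff_posSemidef.2 hone.posSemidef))
  have hStr : S.trace.re = 2 * w := by
    rw [hS, Matrix.trace_add, Matrix.trace_smul, Matrix.trace_smul, hσ.2, Matrix.trace_one]
    simp only [Complex.add_re, Complex.smul_re, Complex.one_re, Complex.natCast_re, smul_eq_mul]
    rw [← hd]
    field_simp
    ring
  set ω := ∑ x, A x with hω
  have hωp : ω.PosSemidef := Matrix.posSemidef_sum _ fun x _ => hAp x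
  have hωtr : ω.trace.re = ρ'.trace.re := by rw [hω, Matrix.trace_sum, Complex.re_sum, hAtr]
  have hfid2 : purifiedDistance (P.hashed A) (P.ideal ω) ≤ η := by
    have h := P.le_fidelity_hashed_ideal (randomFunctionProtocol_uncorrelated X l) hAp
      (hAtr.le.trans hρ'.2.2) hSp hAS (c := 1 / η ^ 2) (by positivity)
    apply purifiedDistance_le_of_fidelity hη.le
    refine le_trans ?_ h
    rw [hcard, hStr]
    -- With c = 1/η² the two error terms are at most η²/4 and η²/2. Half their sum is 3η²/8, within
    -- the allowed η²/2.
    have h1 : 1 / η ^ 2 / 2 * (2 ^ l * (2 * w)) ≤ η ^ 2 / 4 := by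
      rw [div_mul_eq_mul_div, div_mul_eq_mul_div, div_div, div_le_iff₀ (by positivity)]
      nlinarith
    have h2 : 1 / (2 * (1 / η ^ 2)) = η ^ 2 / 2 := by field_simp
    rw [h2]
    nlinarith [sq_nonneg η]
  have hst := P.isState_final ρ
  have hfid1 : purifiedDistance (P.hashed ρ.part) (P.hashed A) ≤ δ := by
    rw [purifiedDistance_comm hρ'.1 ρ.isState_op.1, purifiedDistance_le_iff hδ,
      fidelity_of_trace_eq_one ρ.isState_op.2] at hP
    rw [purifiedDistance_le_iff hδ, fidelity_of_trace_eq_one hst.2]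
    refine hP.trans (pow_le_pow_left₀ (rootFid_nonneg _ _) ?_ 2)
    -- Neither pinching to the diagonal blocks nor hashing decreases the fidelity.
    refine (rootFid_le_sum e ρ.isState_op.1 hρ'.1).trans ?_
    refine le_trans (le_of_eq ?_) (P.sum_rootFid_le_rootFid_hashed ρ.part_posSemidef hAp)
    refine Finset.sum_congr rfl fun x _ => ?_
    rw [ρ.op_eq_blocks, blocks_submatrix]
  have htri : purifiedDistance (P.hashed ρ.part) (P.ideal ω) ≤ δ + η := by
    refine (purifiedDistance_triangle hst.1 (P.hashed_posSemidef hAp) (P.ideal_posSemidef hωp)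
      ?_ ?_ ?_).trans (add_le_add hfid1 hfid2)
    · rw [hst.2, Complex.one_re]
    · rw [P.trace_hashed, Complex.re_sum, hAtr]
      exact hρ'.2.2
    · rw [P.trace_ideal, hωtr]
      exact hρ'.2.2
  set T := ρ'.trace.re with hT
  have hT0 : 0 < T := hρ'.2.1
  have hωT : ω.trace = (T : ℂ) := by
    rw [← hωtr]
    exact (Complex.eq_re_of_ofReal_le (r := 0) (by simpa using hωp.trace_nonneg))
  have hnorm : IsState (T⁻¹ • ω) := by
    refine ⟨smul_posSemidef hωp (by positivity), ?_⟩
    rw [Matrix.trace_smul, hωT, Complex.real_smul, ← Complex.ofReal_mul, inv_mul_cancel₀ hT0.ne',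
      Complex.ofReal_one]
  refine (P.secrecyDistance_le ρ hnorm).trans ?_
  rw [purifiedDistance_le_iff (by positivity), fidelity_of_trace_eq_one hst.2] at htri ⊢
  refine htri.trans (pow_le_pow_left₀ (rootFid_nonneg _ _) ?_ 2)
  -- ω may have trace T < 1, but the ideal state needs a normalized one. Since the final state has
  -- unit trace, only the root fidelity counts, and it can only grow from ω to T⁻¹ ω ≥ ω.
  refine rootFid_mono hst.1 (P.ideal_posSemidef hωp) le_rfl (blocks_mono _ fun q => ?_)
  refine smul_mono (smul_mono ?_ (by positivity)) (P.prob_nonneg _)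
  rw [Matrix.le_iff]
  have h1 : (T⁻¹ - 1) • ω = T⁻¹ • ω - ω := by module
  rw [← h1]
  exact smul_posSemidef hωp (sub_nonneg.2 ((one_le_inv₀ hT0).2 hρ'.2.2))

end Achievability

end OneShot

end

theorem mainTheorem1 {X B : Type*} [Fintype X] [DecidableEq X] [Fintype B] [DecidableEq B]
    (ρ : OneShot.CQState X B) (ε η : ℝ) (hη : 0 < η) (hηε : η ≤ ε) (hε : ε < 1) :
    IsGreatest (OneShot.extractableLengths ε ρ) (OneShot.extractableRandomness ε ρ) ∧
    OneShot.smoothHMin (ε - η) ρ.op - ((Real.logb 2 (1 / η ^ 4) : ℝ) : EReal) - ((3 : ℝ) : EReal)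
      ≤ ((OneShot.extractableRandomness ε ρ : ℝ) : EReal) ∧
    ((OneShot.extractableRandomness ε ρ : ℝ) : EReal) ≤ OneShot.smoothHMin ε ρ.op := by
  have hε0 : 0 ≤ ε := hη.le.trans hηε
  have hbdd := OneShot.bddAbove_extractableLengths ρ hε0 hε
  have hmem : OneShot.extractableRandomness ε ρ ∈ OneShot.extractableLengths ε ρ :=
    Nat.sSup_mem ⟨0, OneShot.zero_mem_extractableLengths ρ hε0⟩ hbdd
  have hub : ∀ l ∈ OneShot.extractableLengths ε ρ, l ≤ OneShot.extractableRandomness ε ρ :=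
    fun l hl => le_csSup hbdd hl
  refine ⟨⟨hmem, hub⟩, ?_, OneShot.natCast_le_smoothHMin hε0 hε hmem⟩
  by_contra! hlt
  set L := OneShot.extractableRandomness ε ρ with hL
  set c := Real.logb 2 (1 / η ^ 4) with hc
  have h1 : (((L : ℝ) + 3 + c : ℝ) : EReal) < OneShot.smoothHMin (ε - η) ρ.op := by
    have h2 := EReal.add_lt_of_lt_sub hlt
    have h3 := EReal.add_lt_of_lt_sub h2
    exact_mod_cast h3
  rw [OneShot.smoothHMin] at h1
  obtain ⟨σ, h1'⟩ := lt_iSup_iff.1 h1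
  obtain ⟨hσ, h2⟩ := lt_iSup_iff.1 h1'
  have h3 : OneShot.smoothDMax (ε - η) ρ.op ((1 : Matrix X X ℂ) ⊗ₖ σ) <
      ((-((L : ℝ) + 3 + c) : ℝ) : EReal) := by
    rw [EReal.coe_neg]
    exact EReal.lt_neg_of_lt_neg h2
  obtain ⟨ρ', h3'⟩ := iInf_lt_iff.1 h3
  obtain ⟨⟨hρ', hP⟩, h4⟩ := iInf_lt_iff.1 h3'
  obtain ⟨t, h4'⟩ := iInf_lt_iff.1 h4
  obtain ⟨ht, h5⟩ := iInf_lt_iff.1 h4'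
  have h6 : t < -((L : ℝ) + 3 + c) := by exact_mod_cast h5
  -- From t < -(L + 3 + c) one gets 2^(L+1) 2^t ≤ 2^(-c-2) = η⁴/4. Of the three bits lost, two pay
  -- for the factor 1/4 and one for rounding to an integer length; L + 1 then contradicts
  -- maximality.
  have hmem' : L + 1 ∈ OneShot.extractableLengths (ε - η + η) ρ := by
    refine OneShot.mem_extractableLengths_of_le (by linarith) hη hσ hρ' hP ht ?_
    have hη4 : η ^ 4 / 4 = (2 : ℝ) ^ (-c - 2) := by
      have : (2 : ℝ) ^ c = 1 / η ^ 4 := Real.rpow_logb (by norm_num) (by norm_num) (by positivity)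
      rw [Real.rpow_sub (by norm_num), Real.rpow_neg (by norm_num), this]
      norm_num
    rw [hη4, ← Real.rpow_natCast, ← Real.rpow_add (by norm_num)]
    apply Real.rpow_le_rpow_of_exponent_le (by norm_num)
    push_cast
    linarith
  rw [sub_add_cancel] at hmem'
  have := hub _ hmem'
  omega
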